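/- **Setting.** Let $\mathcal X=\{1,\dots,k\}$, $h:\mathcal X\to\mathbb R^d$, and let $\mathsf T=\{v\in\mathbb R^k:\sum_x v_x=0,\ \sum_x v_x h(x)=0\}\neq\{0\}$. Assume that $\mathsf T$ is spanned by integer vectors (automatic if $h$ is rational-valued). A *model* consists of a strictly positive probability law $Q$ on $\mathcal X$ and a target $\alpha\in\mathbb R^d$. Its feasible set is $E=\{P: P(x)>0\ \forall x,\ \sum_x P(x)=1,\ \mathbb E_P h=\alpha\}$, and $P^*=\arg\min_{P\in E}D(P\|Q)$ is its information projection, where $D(P\|Q)=\sum_xP(x)\log\frac{P(x)}{Q(x)}$. Its curvature is the smallest eigenvalue $\lambda_{\min}(H^*)$ of $H^*=\Pi\,\mathrm{diag}(1/P^*)\,\Pi$ on $\mathsf T$, where $\Pi$ is the Euclidean orthogonal projection onto $\mathsf T$. Let $E_n$ be the set of empirical laws of samples of size $n$ (types) that lie in $E$. For $T>0$ the *tempered posterior* $\pi_T$ on $E_n$ gives $P$ a weight proportional to $\Pr_{Q^{\otimes n}}(P_n=P)^{1/T}$, where $P_n$ is the empirical law of $n$ i.i.d. draws from $Q$. The *tempered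 predictive law* is $$\mu^T_{n,m}(y)=\sum_{P\in E_n}\Pr(X_{1:m}=y\mid P_n=P)\,\pi_T(P),\qquad y\in\mathcal X^m,$$ with $\Pr(\cdot\mid P_n=P)$ sampling without replacement from $P$. For $T=1$ these are the conditional laws of $P_n$ and of $X_{1:m}$ given $P_n\in E_n$. Let $\mathcal M$ be a family of models with the same $h$ and with $\min_xP^*(x)\ge\delta$ for a common $\delta>0$. For each model and each $n$ let $\widehat\lambda_n$ be a random variable on a probability space (which may depend on the model and on $n$), such that for every $\varepsilon>0$ the probability of $|\widehat\lambda_n-\lambda_{\min}(H^*)|\ge\varepsilon$ tends to $0$ uniformly over $\mathcal M$ (for a single model this is consistency). "With high probability" means that the probability of the complement, among the models of $\mathcal M$ with $E_n\ne\emptyset$, tends to $0$ as $n\to\infty$, uniformly over $\mathcal M$. **Proposition.** 1. Let $0<\ell\le u$ and $0<a\le b$. There is a constant $C$ depending only on $(k,\ell,u,a,b)$ such that, for all $h$, $\delta$, $\mathcal M$ and $\widehat\lambda_n$ as above with $\ell\le\lambda_{\min}(H^*)\le u$ for every model of $\mathcal M$, and for all random temperatures $T_n$ for which the probability of $T_n/\widehat\lambda_n\notin[a,b]$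 tends to $0$ uniformly over $\mathcal M$, with high probability $$\big\|\mu^{T_n}_{n,m}-(P^*)^{\otimes m}\big\|_{\mathrm{TV}}\le C\,m\sqrt{\frac{\log n}{n}}\qquad\text{for all } 0\le m\le n .$$ 2. Let $\beta,\lambda_0>0$ and $T(x)=1+\beta\log(1+x/\lambda_0)$. On every interval $[\ell,u]$ with $0<\ell\le u$, $T(x)/x$ is bounded above and away from zero. Moreover there is a constant $C$ depending only on $(k,\beta,\lambda_0)$, and not on the curvature, such that for all $h$, $\delta$, $\mathcal M$ and $\widehat\lambda_n$ as above and $T_n=T(\widehat\lambda_n)$: * (stable rates) with high probability $\|\mu^{T_n}_{n,m}-(P^*)^{\otimes m}\|_{\mathrm{TV}}\le C\,m\sqrt{\log n/n}$ for all $0\le m\le n$; * (predictive calibration) if $m_n\sqrt{\log n/n}\to0$, then for every $\varepsilon>0$, with high probability, for all $S\subseteq\mathcal X^{m_n}$ the tempered predictive probability $\mu^{T_n}_{n,m_n}(S)$ differs by at most $\varepsilon$ from the actual conditional probability $\mu^{1}_{n,m_n}(S)$ and from $(P^*)^{\otimes m_n}(S)$; * (credible regions) with high probability, for every $t\in\mathbb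 R$ the highest-density region $R=\{P\in E_n:\pi_{T_n}(P)\ge t\}$ satisfies $\pi_1(R)\ge\pi_{T_n}(R)$: its actual conditional coverage is at least its nominal level. -/

import Mathlib

open Filter Topology MeasureTheory
open scoped ENNReal

noncomputable section

namespace Tempering

/-! ### Laws on a finite sample space, moment constraints, information projection -/

/-- The open probability simplex on the sample space `Fin k`. -/
def openSimplex (k : ℕ) : Set (Fin k → ℝ) :=
  {P | (∀ x, 0 < P x) ∧ ∑ x, P x = 1}

/-- The feasible set `E`: strictly positive laws `P` with `𝔼_P[h(X)] = α`, for the feature map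
`h : Fin k → ℝᵈ`. -/
def feasibleSet {k d : ℕ} (h : Fin k → Fin d → ℝ) (α : Fin d → ℝ) : Set (Fin k → ℝ) :=
  {P | P ∈ openSimplex k ∧ ∀ j, ∑ x, P x * h x j = α j}

/-- Kullback--Leibler divergence `D(P‖Q) = ∑ₓ P(x) log (P(x)/Q(x))` (used for positive laws). -/
def klDiv {k : ℕ} (P Q : Fin k → ℝ) : ℝ :=
  ∑ x, P x * Real.log (P x / Q x)

/-- `P` is the information projection of `Q` onto the feasible set:
`P` is the minimiser of `D(· ‖ Q)` over `E`. -/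
def IsInfoProjection {k d : ℕ} (h : Fin k → Fin d → ℝ) (α : Fin d → ℝ)
    (Q P : Fin k → ℝ) : Prop :=
  P ∈ feasibleSet h α ∧ ∀ P' ∈ feasibleSet h α, klDiv P Q ≤ klDiv P' Q

/-- The constrained model with features `h`, targets `α` and strictly positive reference law `Q`
has information projection `P`, and every cell of `P` has probability at least `δ`. -/
def IsModel {k d : ℕ} (h : Fin k → Fin d → ℝ) (δ : ℝ) (Q : Fin k → ℝ) (α : Fin d → ℝ)
    (P : Fin k → ℝ) : Prop :=
  Q ∈ openSimplex k ∧ IsInfoProjection h α Q P ∧ ∀ x, δ ≤ P x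

/-! ### Tangent space and curvature -/

/-- The tangent space `{v | ∑ₓ v(x) = 0, A v = 0}`, with `A = [h(1) ⋯ h(k)]`, as a subspace of
Euclidean space. -/
def tangentSpace {k d : ℕ} (h : Fin k → Fin d → ℝ) : Submodule ℝ (EuclideanSpace ℝ (Fin k)) where
  carrier := {v | ∑ x, v x = 0 ∧ ∀ j, ∑ x, v x * h x j = 0}
  add_mem' := by
    rintro v w ⟨hv, hv'⟩ ⟨hw, hw'⟩
    refine ⟨?_, fun j => ?_⟩
    · simp [Finset.sum_add_distrib, hv, hw]
    · simp [add_mul, Finset.sum_add_distrib, hv' j, hw' j]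
  zero_mem' := by simp
  smul_mem' := by
    rintro c v ⟨hv, hv'⟩
    refine ⟨?_, fun j => ?_⟩
    · simp [← Finset.mul_sum, hv]
    · simp [mul_assoc, ← Finset.mul_sum, hv' j]

/-- The feature map is a lattice feature map: the tangent space is spanned over `ℝ` by the
vectors with integer coordinates that it contains (automatic when `h` has rational values). -/
def IsLatticeFeature {k d : ℕ} (h : Fin k → Fin d → ℝ) : Prop :=
  Submodule.span ℝ {v : EuclideanSpace ℝ (Fin k) | v ∈ tangentSpace h ∧ ∀ x, ∃ z : ℤ, v x = z}
    = tangentSpace h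

/-- The projected Hessian `H* = Π diag(1/P) Π`, as an operator on the tangent space, where `Π` is
the Euclidean orthogonal projection onto the tangent space. -/
def curvatureOperator {k d : ℕ} (h : Fin k → Fin d → ℝ) (P : Fin k → ℝ) :
    Module.End ℝ (tangentSpace h) :=
  (tangentSpace h).orthogonalProjectionOnto.toLinearMap ∘ₗ
    Matrix.toEuclideanLin (Matrix.diagonal fun x => 1 / P x) ∘ₗ (tangentSpace h).subtype

/-- The smallest eigenvalue `λ_min(H*)`. -/
def lambdaMin {k d : ℕ} (h : Fin k → Fin d → ℝ) (P : Fin k → ℝ) : ℝ :=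
  sInf {μ : ℝ | (curvatureOperator h P).HasEigenvalue μ}

/-! ### Empirical types and the tempered posterior -/

/-- The empirical law `c / n` of a sample of size `n` with cell counts `c`. -/
def typeLaw {k : ℕ} (n : ℕ) (c : Fin k → ℕ) : Fin k → ℝ := fun x => (c x : ℝ) / n

open Classical in
/-- The feasible types `E_n = E ∩ 𝒫_n`, each given by its vector of cell counts. -/
def feasibleTypes {k d : ℕ} (h : Fin k → Fin d → ℝ) (α : Fin d → ℝ) (n : ℕ) :
    Finset (Fin k → ℕ) :=
  (Finset.piAntidiag Finset.univ n).filter fun c => typeLaw n c ∈ feasibleSet h α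

/-- The multinomial likelihood `Pr(P_n = c/n)` of a type under i.i.d. sampling from `Q`. -/
def typeProb {k : ℕ} (Q : Fin k → ℝ) (c : Fin k → ℕ) : ℝ :=
  (Nat.multinomial Finset.univ c : ℝ) * ∏ x, Q x ^ c x

/-- The tempered posterior at temperature `T`: the weights of the feasible types are the
multinomial likelihoods raised to the power `1/T`, normalised over `E_n`. At `T = 1` this is
`Pr(P_n = c/n ∣ P_n ∈ E_n)`. -/
def temperedPosterior {k d : ℕ} (h : Fin k → Fin d → ℝ) (α : Fin d → ℝ) (Q : Fin k → ℝ)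
    (T : ℝ) (n : ℕ) (c : Fin k → ℕ) : ℝ :=
  typeProb Q c ^ (1 / T) / ∑ c' ∈ feasibleTypes h α n, typeProb Q c' ^ (1 / T)

/-- The number of occurrences of the symbol `x` in the word `y`. -/
def symbolCount {k m : ℕ} (y : Fin m → Fin k) (x : Fin k) : ℕ :=
  (Finset.univ.filter fun i => y i = x).card

/-- `Pr(X_{1:m} = y ∣ P_n = c/n)`: sampling `m` times without replacement from an urn of `n` balls
of which `c x` carry the symbol `x`. -/
def hypergeometricLaw {k : ℕ} (n m : ℕ) (c : Fin k → ℕ) (y : Fin m → Fin k) : ℝ :=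
  (∏ x, ((c x).descFactorial (symbolCount y x) : ℝ)) / (n.descFactorial m : ℝ)

/-- The tempered predictive law of `m` observations: the mixture of the conditional laws given the
type, under the tempered posterior. At `T = 1` this is the constrained predictive law
`μ_{n,m} = ℒ(X_{1:m} ∣ P_n ∈ E_n)`. -/
def temperedPredictive {k d : ℕ} (h : Fin k → Fin d → ℝ) (α : Fin d → ℝ) (Q : Fin k → ℝ)
    (T : ℝ) (n m : ℕ) (y : Fin m → Fin k) : ℝ :=
  ∑ c ∈ feasibleTypes h α n, hypergeometricLaw n m c y * temperedPosterior h α Q T n c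

/-- The product law `P^{⊗m}`. -/
def productLaw {k : ℕ} (P : Fin k → ℝ) (m : ℕ) (y : Fin m → Fin k) : ℝ := ∏ i, P (y i)

/-- Total variation distance (half the `ℓ¹` distance) between two laws on a finite set. -/
def tvDist {S : Type*} [Fintype S] (μ ν : S → ℝ) : ℝ := (∑ s, |μ s - ν s|) / 2

open Classical in
/-- The highest-posterior-density region of the tempered posterior with density threshold `t`. -/
def hpdRegion {k d : ℕ} (h : Fin k → Fin d → ℝ) (α : Fin d → ℝ) (Q : Fin k → ℝ)
    (T : ℝ) (n : ℕ) (t : ℝ) : Finset (Fin k → ℕ) :=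
  (feasibleTypes h α n).filter fun c => t ≤ temperedPosterior h α Q T n c

/-! ### Temperature and estimated curvature -/

/-- The curvature-adaptive temperature `T(x) = 1 + β log(1 + x/λ₀)`. -/
def logTemperature (β lam0 x : ℝ) : ℝ := 1 + β * Real.log (1 + x / lam0)

/-- The probabilities of the events `B i n` tend to zero as `n → ∞`, uniformly in the model `i`. -/
def UniformlyNegligible {ι : Type*} {Ω : ι → ℕ → Type*} [∀ i n, MeasurableSpace (Ω i n)]
    (ℙ : ∀ i n, Measure (Ω i n)) (B : ∀ i n, Set (Ω i n)) : Prop :=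
  ∀ η : ℝ≥0∞, 0 < η → ∀ᶠ n in atTop, ∀ i, ℙ i n (B i n) ≤ η

/-- `est` is consistent for the curvatures `lam`, uniformly over the models `i`. -/
def IsConsistent {ι : Type*} {Ω : ι → ℕ → Type*} [∀ i n, MeasurableSpace (Ω i n)]
    (ℙ : ∀ i n, Measure (Ω i n)) (est : ∀ i n, Ω i n → ℝ) (lam : ι → ℝ) : Prop :=
  ∀ ε : ℝ, 0 < ε → UniformlyNegligible ℙ fun i n => {ω | ε ≤ |est i n ω - lam i|}

/-- At sample size `n` the tempered predictive laws collapse onto `P^{⊗m}` at the rate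
`C m √(log n / n)`, for all horizons `m ≤ n`. -/
def CollapseBound {k d : ℕ} (h : Fin k → Fin d → ℝ) (α : Fin d → ℝ) (Q P : Fin k → ℝ)
    (T C : ℝ) (n : ℕ) : Prop :=
  ∀ m ≤ n, tvDist (temperedPredictive h α Q T n m) (productLaw P m)
    ≤ C * (m * Real.sqrt (Real.log n / n))

end Tempering

end

/-!
By the Pythagorean identity of the information projection, on `E_n` the likelihoods of a type under
`Q` and under `P*` are proportional, so `Q` may be replaced by `P*` in every posterior. Rounding
along an integral basis of the tangent space puts some feasible type within `O(1 / n)` of `P*`, and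
comparing likelihoods with it, the method of types bounds the posterior weight of `P` by
`(poly(n) * exp (-n * D(P ‖ P*))) ^ (1 / T)`. Near `P*` the divergence is at least a sixth of the
chi-square distance, hence at least `lambdaMin / 6` times the squared Euclidean distance. When
`T ≤ K * lambdaMin` the curvature cancels from the exponent, so that the radius of concentration
depends only on `k` and `K`. Sampling without replacement from a type costs a further `m² / n` in
total variation. Finally `T ≥ 1` flattens the posterior: the likelihood ratio of `π_1` to `π_T`
increases with the density, so highest-density regions have larger `π_1`-mass.
-/

namespace Tempering

variable {k d : ℕ} {h : Fin k → Fin d → ℝ} {α : Fin d → ℝ} {P Q : Fin k → ℝ}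

/-! ### Curvature -/

lemma sInf_eigenvalues_mul_norm_sq_le {E : Type*} [NormedAddCommGroup E] [InnerProductSpace ℝ E]
    [FiniteDimensional ℝ E] {T : Module.End ℝ E} (hT : T.IsSymmetric) (v : E) :
    sInf {μ : ℝ | T.HasEigenvalue μ} * ‖v‖ ^ 2 ≤ inner ℝ (T v) v := by
  let b := hT.eigenvectorBasis rfl
  have hTv : inner ℝ (T v) v = ∑ i, hT.eigenvalues rfl i * inner ℝ (b i) v ^ 2 := by
    rw [← b.sum_inner_mul_inner]
    refine Finset.sum_congr rfl fun i _ => ?_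
    rw [hT v (b i), hT.apply_eigenvectorBasis rfl i, inner_smul_right, real_inner_comm, sq,
      ← mul_assoc]
    rfl
  have hv : ‖v‖ ^ 2 = ∑ i, inner ℝ (b i) v ^ 2 := (b.sum_sq_inner_right v).symm
  rw [hTv, hv, Finset.mul_sum]
  exact Finset.sum_le_sum fun i _ => mul_le_mul_of_nonneg_right
    (csInf_le T.finite_hasEigenvalue.bddBelow (hT.hasEigenvalue_eigenvalues rfl i)) (sq_nonneg _)

lemma hasEigenvalue_sInf_eigenvalues {E : Type*} [NormedAddCommGroup E] [InnerProductSpace ℝ E]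
    [FiniteDimensional ℝ E] [Nontrivial E] {T : Module.End ℝ E} (hT : T.IsSymmetric) :
    T.HasEigenvalue (sInf {μ : ℝ | T.HasEigenvalue μ}) :=
  Set.Nonempty.csInf_mem ⟨_, hT.hasEigenvalue_iInf_of_finiteDimensional⟩ T.finite_hasEigenvalue

lemma inner_curvatureOperator (v w : tangentSpace h) :
    inner ℝ (curvatureOperator h P v) w = ∑ x, v.1 x * w.1 x / P x := by
  simp only [curvatureOperator, LinearMap.comp_apply, ContinuousLinearMap.coe_coe,
    Submodule.subtype_apply]
  rw [Submodule.inner_orthogonalProjectionOnto_eq_of_mem_right, PiLp.inner_apply]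
  refine Finset.sum_congr rfl fun x _ => ?_
  simp [Matrix.toLpLin_apply, Matrix.mulVec_diagonal]
  ring

lemma isSymmetric_curvatureOperator : (curvatureOperator h P).IsSymmetric := fun v w => by
  rw [inner_curvatureOperator, real_inner_comm, inner_curvatureOperator]
  simp only [mul_comm]

lemma inner_curvatureOperator_self (v : tangentSpace h) :
    inner ℝ (curvatureOperator h P v) v = ∑ x, v.1 x ^ 2 / P x := by
  simp only [inner_curvatureOperator, sq]

lemma norm_sq_tangentSpace (v : tangentSpace h) : ‖v‖ ^ 2 = ∑ x, v.1 x ^ 2 := by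
  simp [EuclideanSpace.norm_sq_eq]

lemma lambdaMin_mul_sum_sq_le {v : EuclideanSpace ℝ (Fin k)} (hv : v ∈ tangentSpace h) :
    lambdaMin h P * ∑ x, v x ^ 2 ≤ ∑ x, v x ^ 2 / P x := by
  have hle := sInf_eigenvalues_mul_norm_sq_le
    (isSymmetric_curvatureOperator (h := h) (P := P)) ⟨v, hv⟩
  rwa [inner_curvatureOperator_self, norm_sq_tangentSpace] at hle

lemma exists_mem_tangentSpace_sum_sq_div_eq (hV : tangentSpace h ≠ ⊥) (P : Fin k → ℝ) :
    ∃ v ∈ tangentSpace h, 0 < ∑ x, v x ^ 2 ∧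
      ∑ x, v x ^ 2 / P x = lambdaMin h P * ∑ x, v x ^ 2 := by
  have : Nontrivial (tangentSpace h) := Submodule.nontrivial_iff_ne_bot.2 hV
  obtain ⟨v, hv⟩ := (hasEigenvalue_sInf_eigenvalues
    (isSymmetric_curvatureOperator (h := h) (P := P))).exists_hasEigenvector
  have hv0 : 0 < ‖v‖ ^ 2 := pow_pos (norm_pos_iff.2 hv.2) 2
  refine ⟨v, v.2, by rwa [← norm_sq_tangentSpace], ?_⟩
  rw [← inner_curvatureOperator_self, hv.apply_eq_smul, real_inner_smul_left,
    real_inner_self_eq_norm_sq, norm_sq_tangentSpace]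
  rfl

lemma le_one_of_mem_openSimplex (hP : P ∈ openSimplex k) (x : Fin k) : P x ≤ 1 :=
  hP.2 ▸ Finset.single_le_sum (f := P) (fun y _ => (hP.1 y).le) (Finset.mem_univ x)

lemma one_le_lambdaMin (hV : tangentSpace h ≠ ⊥) (hP : P ∈ openSimplex k) :
    1 ≤ lambdaMin h P := by
  obtain ⟨v, -, hv0, hv⟩ := exists_mem_tangentSpace_sum_sq_div_eq hV P
  refine le_of_mul_le_mul_right ?_ hv0
  rw [one_mul, ← hv]
  exact Finset.sum_le_sum fun x _ =>
    le_div_self (sq_nonneg _) (hP.1 x) (le_one_of_mem_openSimplex hP x)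

lemma lambdaMin_le_one_div (hV : tangentSpace h ≠ ⊥) {δ : ℝ} (hδ : 0 < δ) (hP : ∀ x, δ ≤ P x) :
    lambdaMin h P ≤ 1 / δ := by
  obtain ⟨v, -, hv0, hv⟩ := exists_mem_tangentSpace_sum_sq_div_eq hV P
  refine le_of_mul_le_mul_right ?_ hv0
  rw [← hv, Finset.mul_sum]
  refine Finset.sum_le_sum fun x _ => ?_
  rw [one_div_mul_eq_div]
  exact div_le_div_of_nonneg_left (sq_nonneg _) hδ (hP x)

/-! ### First-order condition for the information projection -/

lemma toLp_sub_mem_tangentSpace (hP : P ∈ feasibleSet h α) (hQ : Q ∈ feasibleSet h α) :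
    WithLp.toLp 2 (Q - P) ∈ tangentSpace h := by
  refine ⟨?_, fun j => ?_⟩
  · simp only [Pi.sub_apply, Finset.sum_sub_distrib, hP.1.2, hQ.1.2, sub_self]
  · simp only [Pi.sub_apply, sub_mul, Finset.sum_sub_distrib, hP.2 j, hQ.2 j, sub_self]

lemma add_mem_feasibleSet (hP : P ∈ feasibleSet h α) {v : EuclideanSpace ℝ (Fin k)}
    (hv : v ∈ tangentSpace h) (hpos : ∀ x, 0 < P x + v x) :
    (fun x => P x + v x) ∈ feasibleSet h α := by
  refine ⟨⟨hpos, ?_⟩, fun j => ?_⟩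
  · rw [Finset.sum_add_distrib, hP.1.2, hv.1, add_zero]
  · simp only [add_mul, Finset.sum_add_distrib, hP.2 j, hv.2 j, add_zero]

lemma hasDerivAt_klDiv_add_mul (hP : ∀ x, 0 < P x) (hQ : ∀ x, 0 < Q x) (v : Fin k → ℝ) :
    HasDerivAt (fun t : ℝ => klDiv (fun x => P x + t * v x) Q)
      (∑ x, (v x * Real.log (P x / Q x) + v x)) 0 := by
  refine HasDerivAt.fun_sum fun x _ => ?_
  have hline : HasDerivAt (fun t : ℝ => P x + t * v x) (v x) 0 := by
    simpa using ((hasDerivAt_id (0 : ℝ)).mul_const (v x)).const_add (P x)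
  have hPx := (hP x).ne'
  have hQx := (hQ x).ne'
  have hlog := (hline.div_const (Q x)).log (by simpa using ⟨hPx, hQx⟩)
  refine (hline.mul hlog).congr_deriv ?_
  rw [zero_mul, add_zero]
  field_simp

lemma sum_mul_log_eq_zero_of_isInfoProjection (hQ : ∀ x, 0 < Q x) (hP : IsInfoProjection h α Q P)
    {v : EuclideanSpace ℝ (Fin k)} (hv : v ∈ tangentSpace h) :
    ∑ x, v x * Real.log (P x / Q x) = 0 := by
  have hmin : IsLocalMin (fun t : ℝ => klDiv (fun x => P x + t * v x) Q) 0 := by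
    have hpos : ∀ᶠ t : ℝ in 𝓝 0, ∀ x, 0 < P x + t * v x := by
      refine eventually_all.2 fun x => ?_
      have hcont : ContinuousAt (fun t : ℝ => P x + t * v x) 0 := by fun_prop
      exact hcont.eventually (lt_mem_nhds (by simpa using hP.1.1.1 x))
    filter_upwards [hpos] with t ht
    simpa using hP.2 _ (add_mem_feasibleSet hP.1 ((tangentSpace h).smul_mem t hv) ht)
  have hderiv := hmin.hasDerivAt_eq_zero (hasDerivAt_klDiv_add_mul hP.1.1.1 hQ v)
  rwa [Finset.sum_add_distrib, hv.1, add_zero] at hderiv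

lemma klDiv_eq_add_of_isInfoProjection (hQ : ∀ x, 0 < Q x) (hP : IsInfoProjection h α Q P)
    {P' : Fin k → ℝ} (hP' : P' ∈ feasibleSet h α) :
    klDiv P' Q = klDiv P' P + klDiv P Q := by
  have hfirst := sum_mul_log_eq_zero_of_isInfoProjection hQ hP (toLp_sub_mem_tangentSpace hP.1 hP')
  rw [← sub_eq_zero, ← hfirst, klDiv, klDiv, klDiv, ← Finset.sum_add_distrib,
    ← Finset.sum_sub_distrib]
  refine Finset.sum_congr rfl fun x _ => ?_
  have hP'x := (hP'.1.1 x).ne'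
  have hPx := (hP.1.1.1 x).ne'
  have hQx := (hQ x).ne'
  rw [Real.log_div hP'x hQx, Real.log_div hP'x hPx, Real.log_div hPx hQx, PiLp.toLp_apply,
    Pi.sub_apply]
  ring

/-! ### Divergence and chi-square distance -/

lemma sq_sqrt_sub_sqrt_le_mul_log_div {p q : ℝ} (hp : 0 < p) (hq : 0 < q) :
    (√p - √q) ^ 2 ≤ p * Real.log (p / q) - p + q := by
  have hlog : Real.log (p / q) = -2 * Real.log (√q / √p) := by
    rw [← Real.sqrt_div' _ hp.le, Real.log_sqrt (div_pos hq hp).le, ← inv_div, Real.log_inv]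
    ring
  have hle : p * Real.log (√q / √p) ≤ p * (√q / √p - 1) :=
    mul_le_mul_of_nonneg_left
      (Real.log_le_sub_one_of_pos (div_pos (Real.sqrt_pos.2 hq) (Real.sqrt_pos.2 hp))) hp.le
  have hmul : p * (√q / √p) = √p * √q := by
    rw [mul_div_assoc', mul_div_right_comm, Real.div_sqrt]
  nlinarith [Real.sq_sqrt hp.le, Real.sq_sqrt hq.le]

lemma sq_sub_div_le_sq_sqrt_sub_sqrt {p q : ℝ} (hp : 0 ≤ p) (hq : 0 ≤ q) :
    (p - q) ^ 2 / (2 * (p + q)) ≤ (√p - √q) ^ 2 := by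
  refine div_le_of_le_mul₀ (by positivity) (sq_nonneg _) ?_
  have hfactor : p - q = (√p - √q) * (√p + √q) := by
    linear_combination Real.sq_sqrt hq - Real.sq_sqrt hp
  have hsum : (√p + √q) ^ 2 ≤ 2 * (p + q) := by
    nlinarith [sq_nonneg (√p - √q), Real.sq_sqrt hp, Real.sq_sqrt hq]
  rw [hfactor, mul_pow]
  exact mul_le_mul_of_nonneg_left hsum (sq_nonneg _)

lemma klDiv_eq_sum_mul_log_sub_add (hPQ : ∑ x, P x = ∑ x, Q x) :
    klDiv P Q = ∑ x, (P x * Real.log (P x / Q x) - P x + Q x) := by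
  rw [Finset.sum_add_distrib, Finset.sum_sub_distrib, hPQ, sub_add_cancel, klDiv]

lemma sum_sq_sub_div_add_le_klDiv (hP : P ∈ openSimplex k) (hQ : Q ∈ openSimplex k) :
    ∑ x, (P x - Q x) ^ 2 / (2 * (P x + Q x)) ≤ klDiv P Q := by
  rw [klDiv_eq_sum_mul_log_sub_add (hP.2.trans hQ.2.symm)]
  exact Finset.sum_le_sum fun x _ =>
    (sq_sub_div_le_sq_sqrt_sub_sqrt (hP.1 x).le (hQ.1 x).le).trans
      (sq_sqrt_sub_sqrt_le_mul_log_div (hP.1 x) (hQ.1 x))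

lemma sum_sq_sub_div_le_klDiv_of_le_two_mul (hP : P ∈ openSimplex k) (hQ : Q ∈ openSimplex k)
    (hPQ : ∀ x, P x ≤ 2 * Q x) : (∑ x, (P x - Q x) ^ 2 / Q x) / 6 ≤ klDiv P Q := by
  refine le_trans ?_ (sum_sq_sub_div_add_le_klDiv hP hQ)
  rw [Finset.sum_div]
  refine Finset.sum_le_sum fun x _ => ?_
  rw [div_div]
  have hPx := hP.1 x
  have hQx := hQ.1 x
  exact div_le_div_of_nonneg_left (sq_nonneg _) (by positivity) (by linarith [hPQ x])

lemma sq_sub_div_four_le_klDiv (hP : P ∈ openSimplex k) (hQ : Q ∈ openSimplex k) (x : Fin k) :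
    (P x - Q x) ^ 2 / 4 ≤ klDiv P Q := by
  have hpos : ∀ y, 0 < 2 * (P y + Q y) := fun y =>
    mul_pos two_pos (add_pos (hP.1 y) (hQ.1 y))
  calc (P x - Q x) ^ 2 / 4 ≤ (P x - Q x) ^ 2 / (2 * (P x + Q x)) :=
        div_le_div_of_nonneg_left (sq_nonneg _) (hpos x) (by
          linarith [le_one_of_mem_openSimplex hP x, le_one_of_mem_openSimplex hQ x])
    _ ≤ ∑ y, (P y - Q y) ^ 2 / (2 * (P y + Q y)) :=
        Finset.single_le_sum (f := fun y => (P y - Q y) ^ 2 / (2 * (P y + Q y)))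
          (fun y _ => div_nonneg (sq_nonneg _) (hpos y).le) (Finset.mem_univ x)
    _ ≤ klDiv P Q := sum_sq_sub_div_add_le_klDiv hP hQ

lemma klDiv_le_sum_sq_sub_div (hP : P ∈ openSimplex k) (hQ : Q ∈ openSimplex k) :
    klDiv P Q ≤ ∑ x, (P x - Q x) ^ 2 / Q x := by
  rw [klDiv_eq_sum_mul_log_sub_add (hP.2.trans hQ.2.symm)]
  refine Finset.sum_le_sum fun x _ => ?_
  have hPx := hP.1 x
  have hQx := hQ.1 x
  have hlog : P x * Real.log (P x / Q x) ≤ P x * (P x / Q x - 1) :=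
    mul_le_mul_of_nonneg_left (Real.log_le_sub_one_of_pos (div_pos hPx hQx)) hPx.le
  have hsq : (P x - Q x) ^ 2 / Q x = P x * (P x / Q x - 1) - P x + Q x := by
    field_simp
    ring
  linarith

/-! ### The method of types -/

lemma factorial_mul_pow_le (a b : ℕ) : a.factorial * a ^ b ≤ b.factorial * a ^ a := by
  rcases le_total a b with hab | hba
  · calc a.factorial * a ^ b = a.factorial * a ^ (b - a) * a ^ a := by
          rw [mul_assoc, ← pow_add, Nat.sub_add_cancel hab]
      _ ≤ b.factorial * a ^ a :=
          Nat.mul_le_mul_right _ (Nat.factorial_mul_pow_sub_le_factorial hab)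
  · have hfact : a.factorial ≤ b.factorial * a ^ (a - b) := by
      rw [← Nat.factorial_mul_descFactorial (Nat.sub_le a b), Nat.sub_sub_self hba]
      exact Nat.mul_le_mul_left _ (Nat.descFactorial_le_pow _ _)
    calc a.factorial * a ^ b ≤ b.factorial * a ^ (a - b) * a ^ b :=
          Nat.mul_le_mul_right _ hfact
      _ = b.factorial * a ^ a := by rw [mul_assoc, ← pow_add, Nat.sub_add_cancel hba]

lemma multinomial_mul_prod_pow_le {ι : Type*} (s : Finset ι) {c c' : ι → ℕ}
    (hcc' : ∑ x ∈ s, c x = ∑ x ∈ s, c' x) :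
    Nat.multinomial s c' * ∏ x ∈ s, c x ^ c' x ≤ Nat.multinomial s c * ∏ x ∈ s, c x ^ c x := by
  have hspec : (∏ x ∈ s, (c' x).factorial) * Nat.multinomial s c'
      = (∏ x ∈ s, (c x).factorial) * Nat.multinomial s c := by
    rw [Nat.multinomial_spec, Nat.multinomial_spec, hcc']
  have hprod : (∏ x ∈ s, (c x).factorial) * ∏ x ∈ s, c x ^ c' x
      ≤ (∏ x ∈ s, (c' x).factorial) * ∏ x ∈ s, c x ^ c x := by
    rw [← Finset.prod_mul_distrib, ← Finset.prod_mul_distrib]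
    exact Finset.prod_le_prod' fun x _ => factorial_mul_pow_le _ _
  have hpos : 0 < (∏ x ∈ s, (c x).factorial) * ∏ x ∈ s, (c' x).factorial :=
    Nat.mul_pos (Finset.prod_pos fun x _ => Nat.factorial_pos _)
      (Finset.prod_pos fun x _ => Nat.factorial_pos _)
  refine Nat.le_of_mul_le_mul_left ?_ hpos
  calc (∏ x ∈ s, (c x).factorial) * (∏ x ∈ s, (c' x).factorial) *
        (Nat.multinomial s c' * ∏ x ∈ s, c x ^ c' x)
      = ((∏ x ∈ s, (c' x).factorial) * Nat.multinomial s c') *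
        ((∏ x ∈ s, (c x).factorial) * ∏ x ∈ s, c x ^ c' x) := by ring
    _ ≤ ((∏ x ∈ s, (c x).factorial) * Nat.multinomial s c) *
        ((∏ x ∈ s, (c' x).factorial) * ∏ x ∈ s, c x ^ c x) := by
        rw [hspec]
        exact Nat.mul_le_mul_left _ hprod
    _ = _ := by ring

lemma card_piAntidiag_univ_le {ι : Type*} [Fintype ι] [DecidableEq ι] (n : ℕ) :
    (Finset.piAntidiag (Finset.univ : Finset ι) n).card ≤ (n + 1) ^ Fintype.card ι := by
  calc (Finset.piAntidiag (Finset.univ : Finset ι) n).card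
      ≤ (Fintype.piFinset fun _ : ι => Finset.range (n + 1)).card := by
        refine Finset.card_le_card fun c hc => Fintype.mem_piFinset.2 fun x => ?_
        rw [Finset.mem_range, Nat.lt_succ_iff, ← (Finset.mem_piAntidiag.1 hc).1]
        exact Finset.single_le_sum (f := c) (fun _ _ => Nat.zero_le _) (Finset.mem_univ x)
    _ = (n + 1) ^ Fintype.card ι := by simp

section Types

variable {n : ℕ} {c c' : Fin k → ℕ}

lemma sum_typeLaw_eq_one_iff : ∑ x, typeLaw n c x = 1 ↔ 0 < n ∧ ∑ x, c x = n := by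
  simp only [typeLaw, ← Finset.sum_div, ← Nat.cast_sum]
  rcases n.eq_zero_or_pos with rfl | hn
  · simp
  · rw [div_eq_one_iff_eq (by positivity), Nat.cast_inj, and_iff_right hn]

lemma typeLaw_nonneg (x : Fin k) : 0 ≤ typeLaw n c x :=
  div_nonneg (Nat.cast_nonneg _) (Nat.cast_nonneg _)

lemma mem_feasibleTypes : c ∈ feasibleTypes h α n ↔ typeLaw n c ∈ feasibleSet h α := by
  simp only [feasibleTypes, Finset.mem_filter, and_iff_right_iff_imp]
  exact fun hc => by simpa using (sum_typeLaw_eq_one_iff.1 hc.1.2).2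

lemma sum_typeProb (hP : ∑ x, P x = 1) (n : ℕ) :
    ∑ c ∈ Finset.piAntidiag Finset.univ n, typeProb P c = 1 := by
  simp only [typeProb, ← Finset.sum_pow_eq_sum_piAntidiag, hP, one_pow]

lemma typeProb_nonneg (hP : ∀ x, 0 ≤ P x) (c : Fin k → ℕ) : 0 ≤ typeProb P c :=
  mul_nonneg (Nat.cast_nonneg _) (Finset.prod_nonneg fun x _ => pow_nonneg (hP x) _)

lemma typeProb_pos (hP : ∀ x, 0 < P x) (c : Fin k → ℕ) : 0 < typeProb P c :=
  mul_pos (Nat.cast_pos.2 (Nat.multinomial_pos _ _)) (Finset.prod_pos fun x _ => pow_pos (hP x) _)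

lemma typeProb_typeLaw_le_one (hc : ∑ x, typeLaw n c x = 1) : typeProb (typeLaw n c) c ≤ 1 := by
  rw [← sum_typeProb hc n]
  exact Finset.single_le_sum (f := typeProb (typeLaw n c))
    (fun c' _ => typeProb_nonneg typeLaw_nonneg c') (by simpa using (sum_typeLaw_eq_one_iff.1 hc).2)

lemma typeProb_typeLaw (he : ∑ x, c' x = n) :
    typeProb (typeLaw n c) c'
      = ((Nat.multinomial Finset.univ c' * ∏ x, c x ^ c' x : ℕ) : ℝ) / (n : ℝ) ^ n := by
  simp only [typeProb, typeLaw, div_pow]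
  rw [Finset.prod_div_distrib, Finset.prod_pow_eq_pow_sum, he]
  push_cast
  ring

lemma typeProb_typeLaw_le (hc : ∑ x, c x = n) (hc' : ∑ x, c' x = n) :
    typeProb (typeLaw n c) c' ≤ typeProb (typeLaw n c) c := by
  rw [typeProb_typeLaw hc', typeProb_typeLaw hc]
  exact div_le_div_of_nonneg_right
    (Nat.cast_le.2 (multinomial_mul_prod_pow_le _ (hc.trans hc'.symm))) (by positivity)

lemma one_le_mul_typeProb_typeLaw (hc : ∑ x, typeLaw n c x = 1) :
    1 ≤ ((n : ℝ) + 1) ^ k * typeProb (typeLaw n c) c := by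
  have hcard : ((Finset.piAntidiag (Finset.univ : Finset (Fin k)) n).card : ℝ)
      ≤ ((n : ℝ) + 1) ^ k := by
    exact_mod_cast (card_piAntidiag_univ_le (ι := Fin k) n).trans_eq (by rw [Fintype.card_fin])
  calc 1 = ∑ c' ∈ Finset.piAntidiag Finset.univ n, typeProb (typeLaw n c) c' :=
        (sum_typeProb hc n).symm
    _ ≤ (Finset.piAntidiag Finset.univ n).card • typeProb (typeLaw n c) c :=
        Finset.sum_le_card_nsmul _ _ _ fun c' hc' =>
          typeProb_typeLaw_le (sum_typeLaw_eq_one_iff.1 hc).2 (by simpa using hc')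
    _ ≤ ((n : ℝ) + 1) ^ k * typeProb (typeLaw n c) c := by
        rw [nsmul_eq_mul]
        exact mul_le_mul_of_nonneg_right hcard (typeProb_nonneg typeLaw_nonneg c)

lemma typeProb_eq_mul_exp_neg_klDiv (hc : ∀ x, 0 < typeLaw n c x) (hP : ∀ x, 0 < P x) :
    typeProb P c = typeProb (typeLaw n c) c * Real.exp (-(n * klDiv (typeLaw n c) P)) := by
  have hexp : Real.exp (-(n * klDiv (typeLaw n c) P)) = ∏ x, (P x / typeLaw n c x) ^ c x := by
    rw [klDiv, Finset.mul_sum, ← Finset.sum_neg_distrib, Real.exp_sum]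
    refine Finset.prod_congr rfl fun x _ => ?_
    have hn : (n : ℝ) ≠ 0 := fun hn => (hc x).ne' (by simp [typeLaw, hn])
    have hcount : (n : ℝ) * typeLaw n c x = c x := mul_div_cancel₀ _ hn
    rw [← mul_assoc, hcount, ← mul_neg, ← Real.log_inv, inv_div, Real.exp_nat_mul,
      Real.exp_log (div_pos (hP x) (hc x))]
  rw [hexp, typeProb, typeProb, mul_assoc, ← Finset.prod_mul_distrib]
  simp only [← mul_pow, mul_div_cancel₀ _ (hc _).ne']

lemma typeProb_le_exp_neg_klDiv (hc : typeLaw n c ∈ openSimplex k) (hP : ∀ x, 0 < P x) :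
    typeProb P c ≤ Real.exp (-(n * klDiv (typeLaw n c) P)) := by
  rw [typeProb_eq_mul_exp_neg_klDiv hc.1 hP]
  exact mul_le_of_le_one_left (Real.exp_pos _).le (typeProb_typeLaw_le_one hc.2)

lemma exp_neg_klDiv_le_mul_typeProb (hc : typeLaw n c ∈ openSimplex k) (hP : ∀ x, 0 < P x) :
    Real.exp (-(n * klDiv (typeLaw n c) P)) ≤ ((n : ℝ) + 1) ^ k * typeProb P c := by
  rw [typeProb_eq_mul_exp_neg_klDiv hc.1 hP, ← mul_assoc]
  exact le_mul_of_one_le_left (Real.exp_pos _).le (one_le_mul_typeProb_typeLaw hc.2)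

end Types

/-! ### Rounding to feasible types -/

lemma exists_mem_span_int_norm_sub_le {E : Type*} [NormedAddCommGroup E] [NormedSpace ℝ E]
    [FiniteDimensional ℝ E] (S : Set E) :
    ∃ B : ℝ, ∀ v ∈ Submodule.span ℝ S, ∃ w ∈ Submodule.span ℤ S, ‖v - w‖ ≤ B := by
  obtain ⟨b, hbS, hspan, hli⟩ := exists_linearIndependent ℝ S
  have : Fintype b := hli.setFinite.fintype
  refine ⟨∑ w : b, ‖w.1‖, fun v hv => ?_⟩
  rw [← hspan, ← Subtype.range_coe (s := b), Submodule.mem_span_range_iff_exists_fun] at hv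
  obtain ⟨a, rfl⟩ := hv
  refine ⟨∑ w : b, ⌊a w⌋ • w.1,
    sum_mem fun w _ => Submodule.smul_mem _ _ (Submodule.subset_span (hbS w.2)), ?_⟩
  rw [← Finset.sum_sub_distrib]
  refine norm_sum_le_of_le _ fun w _ => ?_
  rw [← Int.cast_smul_eq_zsmul ℝ, ← sub_smul, Int.self_sub_floor, norm_smul,
    Real.norm_of_nonneg (Int.fract_nonneg _)]
  exact mul_le_of_le_one_left (norm_nonneg _) (Int.fract_lt_one _).le

lemma exists_int_mem_tangentSpace_abs_sub_le (hL : IsLatticeFeature h) :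
    ∃ B : ℝ, ∀ v ∈ tangentSpace h, ∃ z : Fin k → ℤ,
      WithLp.toLp 2 (fun x => (z x : ℝ)) ∈ tangentSpace h ∧ ∀ x, |v x - z x| ≤ B := by
  set S := {v : EuclideanSpace ℝ (Fin k) | v ∈ tangentSpace h ∧ ∀ x, ∃ z : ℤ, v x = z}
  have hspan : ∀ w ∈ Submodule.span ℤ S, w ∈ S := fun w hw => by
    refine Submodule.span_induction (p := fun w _ => w ∈ S) (fun _ hw => hw)
      ⟨zero_mem _, fun x => ⟨0, by simp⟩⟩ ?_ ?_ hw
    · rintro v w - - ⟨hv, hvz⟩ ⟨hw, hwz⟩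
      refine ⟨add_mem hv hw, fun x => ?_⟩
      obtain ⟨a, ha⟩ := hvz x
      obtain ⟨b, hb⟩ := hwz x
      exact ⟨a + b, by simp [ha, hb]⟩
    · rintro m v - ⟨hv, hvz⟩
      refine ⟨zsmul_mem hv m, fun x => ?_⟩
      obtain ⟨a, ha⟩ := hvz x
      exact ⟨m * a, by simp [ha]⟩
  obtain ⟨B, hB⟩ := exists_mem_span_int_norm_sub_le S
  refine ⟨B, fun v hv => ?_⟩
  rw [← hL] at hv
  obtain ⟨w, hw, hvw⟩ := hB v hv
  obtain ⟨hwT, hwz⟩ := hspan w hw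
  choose z hz using hwz
  refine ⟨z, by simpa only [← hz] using hwT, fun x => ?_⟩
  rw [← hz]
  exact (PiLp.norm_apply_le (v - w) x).trans hvw

lemma exists_mem_feasibleTypes_eq_add {n : ℕ} {c : Fin k → ℕ} (hc : c ∈ feasibleTypes h α n)
    {z : Fin k → ℤ} (hz : WithLp.toLp 2 (fun x => (z x : ℝ)) ∈ tangentSpace h)
    (hpos : ∀ x, 0 < c x + z x) :
    ∃ c' ∈ feasibleTypes h α n, ∀ x, (c' x : ℤ) = c x + z x := by
  lift (fun x => c x + z x : Fin k → ℤ) to Fin k → ℕ using fun x => (hpos x).le with c' hc'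
  have hcast : ∀ x, (c' x : ℤ) = c x + z x := congrFun hc'
  have hn : 0 < n := (sum_typeLaw_eq_one_iff.1 (mem_feasibleTypes.1 hc).1.2).1
  have hlaw : typeLaw n c' = fun x => typeLaw n c x
      + ((n : ℝ)⁻¹ • WithLp.toLp 2 (fun x => (z x : ℝ)) : EuclideanSpace ℝ (Fin k)) x := by
    funext x
    have hcx : (c' x : ℝ) = c x + z x := by exact_mod_cast hcast x
    simp only [typeLaw, hcx, PiLp.smul_apply, smul_eq_mul]
    ring
  refine ⟨c', mem_feasibleTypes.2 ?_, hcast⟩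
  rw [hlaw]
  refine add_mem_feasibleSet (mem_feasibleTypes.1 hc) (Submodule.smul_mem _ _ hz) fun x => ?_
  rw [← congrFun hlaw x]
  have hcx : 0 < c' x := by exact_mod_cast (hcast x).symm ▸ hpos x
  exact div_pos (Nat.cast_pos.2 hcx) (Nat.cast_pos.2 hn)

lemma exists_mem_feasibleTypes_abs_sub_le (hL : IsLatticeFeature h) :
    ∃ B : ℝ, ∀ (α : Fin d → ℝ) (P : Fin k → ℝ) (δ : ℝ) (n : ℕ), P ∈ feasibleSet h α →
      (∀ x, δ ≤ P x) → B < n * δ → (feasibleTypes h α n).Nonempty →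
      ∃ c ∈ feasibleTypes h α n, ∀ x, |typeLaw n c x - P x| ≤ B / n := by
  obtain ⟨B, hB⟩ := exists_int_mem_tangentSpace_abs_sub_le hL
  refine ⟨B, ?_⟩
  rintro α P δ n hP hδ hn ⟨c, hc⟩
  have hn0 : (0 : ℝ) < n :=
    Nat.cast_pos.2 (sum_typeLaw_eq_one_iff.1 (mem_feasibleTypes.1 hc).1.2).1
  obtain ⟨z, hz, hBz⟩ := hB _ (Submodule.smul_mem _ (n : ℝ)
    (toLp_sub_mem_tangentSpace (mem_feasibleTypes.1 hc) hP))
  have hdist : ∀ x, |(c x + z x : ℝ) - n * P x| ≤ B := fun x => by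
    rw [abs_sub_comm]
    refine (congrArg abs ?_).trans_le (hBz x)
    simp only [PiLp.smul_apply, Pi.sub_apply, smul_eq_mul, typeLaw]
    field_simp
    ring
  obtain ⟨c', hc', hcz⟩ := exists_mem_feasibleTypes_eq_add hc hz fun x => by
    have hPx := mul_le_mul_of_nonneg_left (hδ x) hn0.le
    exact_mod_cast (by linarith [(abs_le.1 (hdist x)).1] : (0 : ℝ) < c x + z x)
  refine ⟨c', hc', fun x => ?_⟩
  have hcx : (c' x : ℝ) = c x + z x := by exact_mod_cast hcz x
  have hdiff : typeLaw n c' x - P x = (c x + z x - n * P x) / n := by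
    rw [typeLaw, hcx, sub_div, mul_div_cancel_left₀ _ hn0.ne']
  rw [hdiff, abs_div, abs_of_pos hn0]
  exact div_le_div_of_nonneg_right (hdist x) hn0.le

/-! ### The tempered posterior -/

section Posterior

variable {n : ℕ} {c c₀ : Fin k → ℕ} {T : ℝ}

lemma typeProb_eq_exp_mul_of_isInfoProjection (hQ : ∀ x, 0 < Q x) (hP : IsInfoProjection h α Q P)
    (hc : c ∈ feasibleTypes h α n) :
    typeProb Q c = Real.exp (-(n * klDiv P Q)) * typeProb P c := by
  have hcE := mem_feasibleTypes.1 hc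
  rw [typeProb_eq_mul_exp_neg_klDiv hcE.1.1 hQ, typeProb_eq_mul_exp_neg_klDiv hcE.1.1 hP.1.1.1,
    klDiv_eq_add_of_isInfoProjection hQ hP hcE, mul_add, neg_add, Real.exp_add]
  ring

lemma temperedPosterior_eq_of_isInfoProjection (hQ : ∀ x, 0 < Q x)
    (hP : IsInfoProjection h α Q P) (T : ℝ) (hc : c ∈ feasibleTypes h α n) :
    temperedPosterior h α Q T n c = temperedPosterior h α P T n c := by
  have hpow : ∀ e ∈ feasibleTypes h α n, typeProb Q e ^ (1 / T)
      = Real.exp (-(n * klDiv P Q)) ^ (1 / T) * typeProb P e ^ (1 / T) := fun e he => by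
    rw [typeProb_eq_exp_mul_of_isInfoProjection hQ hP he,
      Real.mul_rpow (Real.exp_pos _).le (typeProb_pos hP.1.1.1 e).le]
  rw [temperedPosterior, temperedPosterior, hpow c hc, Finset.sum_congr rfl hpow,
    ← Finset.mul_sum, mul_div_mul_left _ _ (Real.rpow_pos_of_pos (Real.exp_pos _) _).ne']

lemma temperedPredictive_eq_of_isInfoProjection (hQ : ∀ x, 0 < Q x)
    (hP : IsInfoProjection h α Q P) (T : ℝ) (n m : ℕ) :
    temperedPredictive h α Q T n m = temperedPredictive h α P T n m := by
  funext y
  exact Finset.sum_congr rfl fun c hc => by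
    rw [temperedPosterior_eq_of_isInfoProjection hQ hP T hc]

lemma temperedPosterior_nonneg (hQ : ∀ x, 0 ≤ Q x) : 0 ≤ temperedPosterior h α Q T n c :=
  div_nonneg (Real.rpow_nonneg (typeProb_nonneg hQ c) _)
    (Finset.sum_nonneg fun e _ => Real.rpow_nonneg (typeProb_nonneg hQ e) _)

lemma sum_typeProb_rpow_pos (hQ : ∀ x, 0 < Q x) (hE : (feasibleTypes h α n).Nonempty) (s : ℝ) :
    0 < ∑ c ∈ feasibleTypes h α n, typeProb Q c ^ s :=
  Finset.sum_pos (fun c _ => Real.rpow_pos_of_pos (typeProb_pos hQ c) _) hE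

lemma sum_temperedPosterior (hQ : ∀ x, 0 < Q x) (hE : (feasibleTypes h α n).Nonempty) (T : ℝ) :
    ∑ c ∈ feasibleTypes h α n, temperedPosterior h α Q T n c = 1 := by
  simp only [temperedPosterior, ← Finset.sum_div]
  exact div_self (sum_typeProb_rpow_pos hQ hE _).ne'

lemma temperedPosterior_le_rpow_div (hQ : ∀ x, 0 < Q x) (hc₀ : c₀ ∈ feasibleTypes h α n) :
    temperedPosterior h α Q T n c ≤ (typeProb Q c / typeProb Q c₀) ^ (1 / T) := by
  have hpos := typeProb_pos hQ
  rw [temperedPosterior, Real.div_rpow (hpos c).le (hpos c₀).le]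
  exact div_le_div_of_nonneg_left (Real.rpow_nonneg (hpos c).le _)
    (Real.rpow_pos_of_pos (hpos c₀) _)
    (Finset.single_le_sum (f := fun e => typeProb Q e ^ (1 / T))
      (fun e _ => Real.rpow_nonneg (hpos e).le _) hc₀)

lemma typeProb_div_typeProb_le (hc : typeLaw n c ∈ openSimplex k)
    (hc₀ : typeLaw n c₀ ∈ openSimplex k) (hP : ∀ x, 0 < P x) :
    typeProb P c / typeProb P c₀ ≤ ((n : ℝ) + 1) ^ k *
      Real.exp (n * klDiv (typeLaw n c₀) P - n * klDiv (typeLaw n c) P) := by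
  rw [div_le_iff₀ (typeProb_pos hP c₀)]
  calc typeProb P c
      ≤ Real.exp (n * klDiv (typeLaw n c₀) P - n * klDiv (typeLaw n c) P)
          * Real.exp (-(n * klDiv (typeLaw n c₀) P)) := by
        rw [← Real.exp_add, sub_add_eq_add_sub, add_neg_cancel, zero_sub]
        exact typeProb_le_exp_neg_klDiv hc hP
    _ ≤ Real.exp (n * klDiv (typeLaw n c₀) P - n * klDiv (typeLaw n c) P)
          * (((n : ℝ) + 1) ^ k * typeProb P c₀) :=
        mul_le_mul_of_nonneg_left (exp_neg_klDiv_le_mul_typeProb hc₀ hP) (Real.exp_pos _).le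
    _ = _ := by ring

lemma add_one_pow_le_exp_log (hn : 2 ≤ n) (k : ℕ) :
    ((n : ℝ) + 1) ^ k ≤ Real.exp (2 * k * Real.log n) := by
  have hn0 : (0 : ℝ) < n := by positivity
  have hle : (n : ℝ) + 1 ≤ (n : ℝ) ^ 2 := by exact_mod_cast (by nlinarith : n + 1 ≤ n ^ 2)
  calc ((n : ℝ) + 1) ^ k ≤ ((n : ℝ) ^ 2) ^ k := pow_le_pow_left₀ (by positivity) hle k
    _ = Real.exp (2 * k * Real.log n) := by
        rw [← pow_mul, ← Real.exp_log (pow_pos hn0 _), Real.log_pow]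
        push_cast
        rfl

lemma one_le_log_of_three_le (hn : 3 ≤ n) : 1 ≤ Real.log n := by
  have hn3 : (3 : ℝ) ≤ n := by exact_mod_cast hn
  rw [Real.le_log_iff_exp_le (by linarith)]
  linarith [Real.exp_one_lt_d9]

lemma temperedPosterior_le_exp_neg (hP : ∀ x, 0 < P x) (hT : 0 < T) (hn : 3 ≤ n)
    (hc : typeLaw n c ∈ openSimplex k) (hc₀ : c₀ ∈ feasibleTypes h α n)
    (hnear : n * klDiv (typeLaw n c₀) P ≤ 1)
    (hfar : (2 * k + 1) * (1 + T) * Real.log n ≤ n * klDiv (typeLaw n c) P) :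
    temperedPosterior h α P T n c ≤ Real.exp (-((2 * k + 1) * Real.log n)) := by
  have hratio : typeProb P c / typeProb P c₀ ≤ Real.exp (-((2 * k + 1) * Real.log n) * T) :=
    calc typeProb P c / typeProb P c₀
        ≤ Real.exp (2 * k * Real.log n) *
            Real.exp (n * klDiv (typeLaw n c₀) P - n * klDiv (typeLaw n c) P) :=
          (typeProb_div_typeProb_le hc (mem_feasibleTypes.1 hc₀).1 hP).trans
            (mul_le_mul_of_nonneg_right (add_one_pow_le_exp_log (by lia) k) (Real.exp_pos _).le)
      _ ≤ Real.exp (-((2 * k + 1) * Real.log n) * T) := by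
          rw [← Real.exp_add, Real.exp_le_exp]
          linarith [one_le_log_of_three_le hn]
  calc temperedPosterior h α P T n c ≤ (typeProb P c / typeProb P c₀) ^ (1 / T) :=
        temperedPosterior_le_rpow_div hP hc₀
    _ ≤ Real.exp (-((2 * k + 1) * Real.log n) * T) ^ (1 / T) :=
        Real.rpow_le_rpow (div_nonneg (typeProb_pos hP c).le (typeProb_pos hP c₀).le) hratio
          (by positivity)
    _ = Real.exp (-((2 * k + 1) * Real.log n)) := by
        rw [← Real.exp_mul, mul_assoc, mul_one_div_cancel hT.ne', mul_one]

end Posterior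

/-! ### Total variation distance -/

section TotalVariation

variable {S : Type*} [Fintype S] {μ ν : S → ℝ}

lemma tvDist_triangle (μ ν ρ : S → ℝ) : tvDist μ ρ ≤ tvDist μ ν + tvDist ν ρ := by
  rw [tvDist, tvDist, tvDist, ← add_div, ← Finset.sum_add_distrib]
  exact div_le_div_of_nonneg_right
    (Finset.sum_le_sum fun s _ => abs_sub_le (μ s) (ν s) (ρ s)) zero_le_two

lemma tvDist_le_one (hμ : μ ∈ stdSimplex ℝ S) (hν : ν ∈ stdSimplex ℝ S) : tvDist μ ν ≤ 1 := by
  rw [tvDist, div_le_one two_pos]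
  calc ∑ s, |μ s - ν s| ≤ ∑ s, (μ s + ν s) := Finset.sum_le_sum fun s _ =>
        abs_le.2 ⟨by linarith [hμ.1 s], by linarith [hν.1 s]⟩
    _ = 2 := by rw [Finset.sum_add_distrib, hμ.2, hν.2, one_add_one_eq_two]

lemma tvDist_le_one_sub_of_mul_le {ρ : ℝ} (hμ : μ ∈ stdSimplex ℝ S) (hν : ∑ s, ν s = 1)
    (hρ : ρ ≤ 1) (hle : ∀ s, ρ * μ s ≤ ν s) : tvDist μ ν ≤ 1 - ρ := by
  rw [tvDist, div_le_iff₀ two_pos]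
  calc ∑ s, |μ s - ν s| ≤ ∑ s, (2 * ((1 - ρ) * μ s) - (μ s - ν s)) := by
        refine Finset.sum_le_sum fun s _ => abs_le.2 ?_
        have hρμ := mul_nonneg (sub_nonneg.2 hρ) (hμ.1 s)
        constructor <;> linarith [hle s]
    _ = (1 - ρ) * 2 := by
        simp only [Finset.sum_sub_distrib, ← Finset.mul_sum, hμ.2, hν]
        ring

lemma tvDist_sum_mul_le {ι : Type*} (C : Finset ι) {w : ι → ℝ} (hw0 : ∀ c ∈ C, 0 ≤ w c)
    (hw : ∑ c ∈ C, w c = 1) (μ : ι → S → ℝ) (ν : S → ℝ) :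
    tvDist (fun s => ∑ c ∈ C, μ c s * w c) ν ≤ ∑ c ∈ C, w c * tvDist (μ c) ν := by
  simp only [tvDist, mul_div_assoc', ← Finset.sum_div, Finset.mul_sum]
  rw [Finset.sum_comm (s := C)]
  refine div_le_div_of_nonneg_right (Finset.sum_le_sum fun s _ => ?_) zero_le_two
  have hdiff : ∑ c ∈ C, μ c s * w c - ν s = ∑ c ∈ C, w c * (μ c s - ν s) := by
    simp only [mul_comm (μ _ s), mul_sub, Finset.sum_sub_distrib, ← Finset.sum_mul, hw, one_mul]
  rw [hdiff]
  refine (Finset.abs_sum_le_sum_abs _ _).trans_eq (Finset.sum_congr rfl fun c hc => ?_)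
  rw [abs_mul, abs_of_nonneg (hw0 c hc)]

lemma abs_sum_sub_sum_le_tvDist (hμν : ∑ s, μ s = ∑ s, ν s) (A : Finset S) :
    |∑ s ∈ A, μ s - ∑ s ∈ A, ν s| ≤ tvDist μ ν := by
  classical
  have hcompl : ∑ s ∈ Aᶜ, (μ s - ν s) = -∑ s ∈ A, (μ s - ν s) := by
    rw [eq_neg_iff_add_eq_zero, Finset.sum_compl_add_sum, Finset.sum_sub_distrib, hμν, sub_self]
  rw [← Finset.sum_sub_distrib, tvDist, le_div_iff₀ two_pos, mul_two]
  calc |∑ s ∈ A, (μ s - ν s)| + |∑ s ∈ A, (μ s - ν s)|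
      = |∑ s ∈ A, (μ s - ν s)| + |∑ s ∈ Aᶜ, (μ s - ν s)| := by rw [hcompl, abs_neg]
    _ ≤ ∑ s ∈ A, |μ s - ν s| + ∑ s ∈ Aᶜ, |μ s - ν s| :=
        add_le_add (Finset.abs_sum_le_sum_abs _ _) (Finset.abs_sum_le_sum_abs _ _)
    _ = ∑ s, |μ s - ν s| := Finset.sum_add_sum_compl _ _

lemma tvDist_le_sqrt_card_mul_sum_sq (μ ν : S → ℝ) :
    tvDist μ ν ≤ √(Fintype.card S * ∑ s, (μ s - ν s) ^ 2) / 2 := by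
  refine div_le_div_of_nonneg_right (Real.le_sqrt_of_sq_le ?_) zero_le_two
  simpa only [sq_abs, Finset.card_univ] using
    sq_sum_le_card_mul_sum_sq (s := Finset.univ) (f := fun s => |μ s - ν s|)

end TotalVariation

/-! ### Sampling with and without replacement -/

lemma openSimplex_subset_stdSimplex : openSimplex k ⊆ stdSimplex ℝ (Fin k) :=
  fun _ hP => ⟨fun x => (hP.1 x).le, hP.2⟩

section Sampling

variable {m n : ℕ} {c : Fin k → ℕ}

lemma symbolCount_cons (a : Fin k) (y : Fin m → Fin k) (x : Fin k) :
    symbolCount (Fin.cons a y : Fin (m + 1) → Fin k) x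
      = symbolCount y x + if a = x then 1 else 0 := by
  simp only [symbolCount, Finset.card_filter, Fin.sum_univ_succ, Fin.cons_zero, Fin.cons_succ,
    add_comm]

lemma sum_symbolCount (y : Fin m → Fin k) : ∑ x, symbolCount y x = m := by
  simp only [symbolCount, ← Finset.card_eq_sum_card_fiberwise
    (fun _ _ => Finset.mem_coe.2 (Finset.mem_univ _)), Finset.card_univ, Fintype.card_fin]

lemma sum_words_succ {M : Type*} [AddCommMonoid M] (f : (Fin (m + 1) → Fin k) → M) :
    ∑ y, f y = ∑ y : Fin m → Fin k, ∑ a, f (Fin.cons a y) := by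
  rw [← (Fin.consEquiv fun _ : Fin (m + 1) => Fin k).sum_comp, Fintype.sum_prod_type,
    Finset.sum_comm]
  rfl

lemma prod_descFactorial_symbolCount_cons (c : Fin k → ℕ) (a : Fin k) (y : Fin m → Fin k) :
    ∏ x, (c x).descFactorial (symbolCount (Fin.cons a y : Fin (m + 1) → Fin k) x)
      = (c a - symbolCount y a) * ∏ x, (c x).descFactorial (symbolCount y x) := by
  have hfactor : ∀ x, (c x).descFactorial (symbolCount y x + if a = x then 1 else 0)
      = (if a = x then c x - symbolCount y x else 1) * (c x).descFactorial (symbolCount y x) :=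
    fun x => by split_ifs <;> simp [Nat.descFactorial_succ]
  simp only [symbolCount_cons, hfactor, Finset.prod_mul_distrib, Finset.prod_ite_eq,
    Finset.mem_univ, if_true]

lemma sum_sub_symbolCount_mul_prod_descFactorial (c : Fin k → ℕ) (y : Fin m → Fin k) :
    (∑ a, (c a - symbolCount y a)) * ∏ x, (c x).descFactorial (symbolCount y x)
      = (∑ x, c x - m) * ∏ x, (c x).descFactorial (symbolCount y x) := by
  by_cases hle : ∀ x, symbolCount y x ≤ c x
  · rw [Finset.sum_tsub_distrib _ fun x _ => hle x, sum_symbolCount]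
  · push Not at hle
    obtain ⟨x, hx⟩ := hle
    rw [Finset.prod_eq_zero (Finset.mem_univ x) (Nat.descFactorial_eq_zero_iff_lt.2 hx),
      mul_zero, mul_zero]

lemma sum_prod_descFactorial_symbolCount (c : Fin k → ℕ) (m : ℕ) :
    ∑ y : Fin m → Fin k, ∏ x, (c x).descFactorial (symbolCount y x)
      = (∑ x, c x).descFactorial m := by
  induction m with
  | zero => simp [symbolCount]
  | succ m ih =>
    simp only [sum_words_succ, prod_descFactorial_symbolCount_cons, ← Finset.sum_mul,
      sum_sub_symbolCount_mul_prod_descFactorial]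
    rw [← Finset.mul_sum, ih, Nat.descFactorial_succ]

lemma hypergeometricLaw_mem_stdSimplex (hc : ∑ x, c x = n) (hm : m ≤ n) :
    hypergeometricLaw n m c ∈ stdSimplex ℝ (Fin m → Fin k) := by
  refine ⟨fun y => div_nonneg (Finset.prod_nonneg fun _ _ => Nat.cast_nonneg _)
    (Nat.cast_nonneg _), ?_⟩
  have hsum := sum_prod_descFactorial_symbolCount c m
  rw [hc] at hsum
  simp only [hypergeometricLaw, ← Finset.sum_div]
  rw [div_eq_one_iff_eq (Nat.cast_ne_zero.2 (Nat.descFactorial_pos.2 hm).ne')]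
  exact_mod_cast hsum

lemma productLaw_mem_stdSimplex (hP : P ∈ stdSimplex ℝ (Fin k)) (m : ℕ) :
    productLaw P m ∈ stdSimplex ℝ (Fin m → Fin k) :=
  ⟨fun _ => Finset.prod_nonneg fun _ _ => hP.1 _, by
    simp only [productLaw, ← Fintype.sum_pow, hP.2, one_pow]⟩

lemma productLaw_cons (P : Fin k → ℝ) (a : Fin k) (y : Fin m → Fin k) :
    productLaw P (m + 1) (Fin.cons a y) = P a * productLaw P m y := by
  simp only [productLaw, Fin.prod_univ_succ, Fin.cons_zero, Fin.cons_succ]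

lemma productLaw_eq_prod_pow (P : Fin k → ℝ) (y : Fin m → Fin k) :
    productLaw P m y = ∏ x, P x ^ symbolCount y x := by
  rw [productLaw, ← Finset.prod_fiberwise_of_maps_to (g := y) (t := Finset.univ)
    (fun _ _ => Finset.mem_univ _)]
  refine Finset.prod_congr rfl fun x _ => ?_
  rw [symbolCount, ← Finset.prod_const]
  exact Finset.prod_congr rfl fun i hi => by rw [(Finset.mem_filter.1 hi).2]

lemma tvDist_productLaw_le (hP : P ∈ stdSimplex ℝ (Fin k)) (hQ : Q ∈ stdSimplex ℝ (Fin k))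
    (m : ℕ) : tvDist (productLaw P m) (productLaw Q m) ≤ m * tvDist P Q := by
  simp only [tvDist, mul_div_assoc']
  refine div_le_div_of_nonneg_right ?_ zero_le_two
  induction m with
  | zero => simp [productLaw]
  | succ m ih =>
    have hterm : ∀ (y : Fin m → Fin k) a, |P a * productLaw P m y - Q a * productLaw Q m y|
        ≤ P a * |productLaw P m y - productLaw Q m y| + |P a - Q a| * productLaw Q m y :=
      fun y a => by
        have hsplit : P a * productLaw P m y - Q a * productLaw Q m y
            = P a * (productLaw P m y - productLaw Q m y) + (P a - Q a) * productLaw Q m y := by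
          ring
        rw [hsplit]
        refine (abs_add_le _ _).trans_eq ?_
        rw [abs_mul, abs_mul, abs_of_nonneg (hP.1 a),
          abs_of_nonneg ((productLaw_mem_stdSimplex hQ m).1 y)]
    calc ∑ y, |productLaw P (m + 1) y - productLaw Q (m + 1) y|
        ≤ ∑ y : Fin m → Fin k, ∑ a, (P a * |productLaw P m y - productLaw Q m y|
            + |P a - Q a| * productLaw Q m y) := by
          simp only [sum_words_succ, productLaw_cons]
          exact Finset.sum_le_sum fun y _ => Finset.sum_le_sum fun a _ => hterm y a
      _ = ∑ y, |productLaw P m y - productLaw Q m y| + ∑ x, |P x - Q x| := by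
          simp only [Finset.sum_add_distrib, ← Finset.sum_mul, ← Finset.mul_sum, hP.2, one_mul,
            (productLaw_mem_stdSimplex hQ m).2, mul_one]
      _ ≤ (m + 1 : ℕ) * ∑ x, |P x - Q x| := by
          rw [Nat.cast_succ, add_one_mul]
          exact add_le_add_left ih _

lemma one_sub_sq_div_le_descFactorial_div_pow (hm : m ≤ n) :
    1 - (m : ℝ) ^ 2 / n ≤ (n.descFactorial m : ℝ) / (n : ℝ) ^ m := by
  rcases n.eq_zero_or_pos with rfl | hn
  · simp [Nat.le_zero.1 hm]
  have hn' : (0 : ℝ) < n := by positivity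
  have hmn : (m : ℝ) / n ≤ 1 := (div_le_one hn').2 (by exact_mod_cast hm)
  calc 1 - (m : ℝ) ^ 2 / n = 1 + m * -((m : ℝ) / n) := by ring
    _ ≤ (1 + -((m : ℝ) / n)) ^ m := one_add_mul_le_pow (by linarith) m
    _ = ((n - m : ℕ) : ℝ) ^ m / (n : ℝ) ^ m := by
        rw [← div_pow, Nat.cast_sub hm, sub_div, div_self hn'.ne', sub_eq_add_neg]
    _ ≤ (n.descFactorial m : ℝ) / (n : ℝ) ^ m := by
        gcongr
        exact_mod_cast (Nat.pow_le_pow_left (by lia) m).trans (Nat.pow_sub_le_descFactorial n m)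

lemma descFactorial_div_pow_mul_hypergeometricLaw_le (hm : m ≤ n) (c : Fin k → ℕ)
    (y : Fin m → Fin k) :
    (n.descFactorial m : ℝ) / (n : ℝ) ^ m * hypergeometricLaw n m c y
      ≤ productLaw (typeLaw n c) m y := by
  have hdesc : (n.descFactorial m : ℝ) ≠ 0 := Nat.cast_ne_zero.2 (Nat.descFactorial_pos.2 hm).ne'
  rw [productLaw_eq_prod_pow, hypergeometricLaw, div_mul_div_comm, mul_comm,
    mul_div_mul_right _ _ hdesc]
  simp only [typeLaw, div_pow]
  rw [Finset.prod_div_distrib, Finset.prod_pow_eq_pow_sum, sum_symbolCount]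
  gcongr with x
  exact_mod_cast Nat.descFactorial_le_pow _ _

lemma tvDist_hypergeometricLaw_productLaw_le (hc : ∑ x, typeLaw n c x = 1) (hm : m ≤ n) :
    tvDist (hypergeometricLaw n m c) (productLaw (typeLaw n c) m) ≤ (m : ℝ) ^ 2 / n := by
  have hle := tvDist_le_one_sub_of_mul_le
    (hypergeometricLaw_mem_stdSimplex (sum_typeLaw_eq_one_iff.1 hc).2 hm)
    (productLaw_mem_stdSimplex ⟨typeLaw_nonneg, hc⟩ m).2
    (div_le_one_of_le₀ (by exact_mod_cast Nat.descFactorial_le_pow n m) (by positivity))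
    (descFactorial_div_pow_mul_hypergeometricLaw_le hm c)
  linarith [one_sub_sq_div_le_descFactorial_div_pow hm]

end Sampling

/-! ### Concentration of the tempered posterior -/

lemma sum_mul_le_add_card_mul {ι : Type*} {C : Finset ι} {w f : ι → ℝ} {r η : ℝ}
    (hw0 : ∀ c ∈ C, 0 ≤ w c) (hw : ∑ c ∈ C, w c = 1) (hr : 0 ≤ r) (hη : 0 ≤ η)
    (hf : ∀ c ∈ C, f c ≤ 1) (hclose : ∀ c ∈ C, f c ≤ r ∨ w c ≤ η) :
    ∑ c ∈ C, w c * f c ≤ r + C.card * η := by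
  have hterm : ∀ c ∈ C, w c * f c ≤ w c * r + η := fun c hc => by
    rcases hclose c hc with hfr | hwη
    · exact le_add_of_le_of_nonneg (mul_le_mul_of_nonneg_left hfr (hw0 c hc)) hη
    · exact le_add_of_nonneg_of_le (mul_nonneg (hw0 c hc) hr)
        ((mul_le_of_le_one_right (hw0 c hc) (hf c hc)).trans hwη)
  refine (Finset.sum_le_sum hterm).trans_eq ?_
  rw [Finset.sum_add_distrib, ← Finset.sum_mul, hw, one_mul, Finset.sum_const, nsmul_eq_mul]

section Concentration

variable {δ K T : ℝ} {n : ℕ} {c c₀ : Fin k → ℕ}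

lemma lambdaMin_mul_sum_sq_sub_div_six_le_klDiv (hP : P ∈ feasibleSet h α)
    (hQ : Q ∈ feasibleSet h α) (hPQ : ∀ x, P x ≤ 2 * Q x) :
    lambdaMin h Q * (∑ x, (P x - Q x) ^ 2) / 6 ≤ klDiv P Q := by
  have hquad := lambdaMin_mul_sum_sq_le (P := Q) (toLp_sub_mem_tangentSpace hQ hP)
  simp only [Pi.sub_apply] at hquad
  exact (div_le_div_of_nonneg_right hquad (by norm_num)).trans
    (sum_sq_sub_div_le_klDiv_of_le_two_mul hP.1 hQ.1 hPQ)

lemma sq_div_four_le_klDiv (hP : P ∈ openSimplex k) (hQ : Q ∈ openSimplex k) (hδ : 0 ≤ δ)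
    {x : Fin k} (hδQ : δ ≤ Q x) (hx : 2 * Q x ≤ P x) : δ ^ 2 / 4 ≤ klDiv P Q :=
  (div_le_div_of_nonneg_right (pow_le_pow_left₀ hδ (by linarith) 2) (by norm_num)).trans
    (sq_sub_div_four_le_klDiv hP hQ x)

lemma mul_log_le_mul_klDiv_of_far (hV : tangentSpace h ≠ ⊥) (hP : P ∈ feasibleSet h α)
    (hδ : 0 < δ) (hPδ : ∀ x, δ ≤ P x) (hK : 0 ≤ K) (hTK : T ≤ K * lambdaMin h P) (hn : 0 < n)
    (hnδ : (2 * k + 1) * (1 + K / δ) * Real.log n ≤ n * (δ ^ 2 / 4))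
    (hc : typeLaw n c ∈ feasibleSet h α)
    (hfar : 6 * (2 * k + 1) * (1 + K) * (Real.log n / n) ≤ ∑ x, (typeLaw n c x - P x) ^ 2) :
    (2 * k + 1) * (1 + T) * Real.log n ≤ n * klDiv (typeLaw n c) P := by
  have hn0 : (0 : ℝ) < n := by exact_mod_cast hn
  have := Real.log_natCast_nonneg n
  have hlam := one_le_lambdaMin hV hP.1
  by_cases hnear : ∀ x, typeLaw n c x ≤ 2 * P x
  · calc (2 * k + 1) * (1 + T) * Real.log n
        ≤ (2 * k + 1) * (lambdaMin h P * (1 + K)) * Real.log n := by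
          gcongr
          linarith
      _ = n * (lambdaMin h P * (6 * (2 * k + 1) * (1 + K) * (Real.log n / n)) / 6) := by
          field_simp
      _ ≤ n * (lambdaMin h P * (∑ x, (typeLaw n c x - P x) ^ 2) / 6) := by gcongr
      _ ≤ n * klDiv (typeLaw n c) P := mul_le_mul_of_nonneg_left
          (lambdaMin_mul_sum_sq_sub_div_six_le_klDiv hc hP hnear) hn0.le
  · push Not at hnear
    obtain ⟨x, hx⟩ := hnear
    have hTδ : T ≤ K / δ := by
      rw [div_eq_mul_one_div]
      exact hTK.trans (mul_le_mul_of_nonneg_left (lambdaMin_le_one_div hV hδ hPδ) hK)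
    calc (2 * k + 1) * (1 + T) * Real.log n ≤ (2 * k + 1) * (1 + K / δ) * Real.log n := by gcongr
      _ ≤ n * (δ ^ 2 / 4) := hnδ
      _ ≤ n * klDiv (typeLaw n c) P := mul_le_mul_of_nonneg_left
          (sq_div_four_le_klDiv hc.1 hP.1 hδ.le (hPδ x) hx.le) hn0.le

lemma card_feasibleTypes_le (h : Fin k → Fin d → ℝ) (α : Fin d → ℝ) (n : ℕ) :
    (feasibleTypes h α n).card ≤ (n + 1) ^ k := by
  classical
  exact (Finset.card_filter_le _ _).trans (by simpa using card_piAntidiag_univ_le (ι := Fin k) n)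

lemma card_feasibleTypes_mul_exp_neg_le (h : Fin k → Fin d → ℝ) (α : Fin d → ℝ) (hn : 2 ≤ n) :
    (feasibleTypes h α n).card * Real.exp (-((2 * k + 1) * Real.log n)) ≤ 1 / n := by
  have hcard : ((feasibleTypes h α n).card : ℝ) ≤ Real.exp (2 * k * Real.log n) :=
    le_trans (by exact_mod_cast card_feasibleTypes_le h α n) (add_one_pow_le_exp_log hn k)
  calc (feasibleTypes h α n).card * Real.exp (-((2 * k + 1) * Real.log n))
      ≤ Real.exp (2 * k * Real.log n) * Real.exp (-((2 * k + 1) * Real.log n)) := by gcongr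
    _ = Real.exp (-Real.log n) := by
        rw [← Real.exp_add]
        ring_nf
    _ = 1 / n := by rw [Real.exp_neg, Real.exp_log (by positivity), one_div]

lemma sum_temperedPosterior_mul_tvDist_le (hV : tangentSpace h ≠ ⊥) (hP : P ∈ feasibleSet h α)
    (hδ : 0 < δ) (hPδ : ∀ x, δ ≤ P x) (hK : 0 ≤ K) (hT : 0 < T) (hTK : T ≤ K * lambdaMin h P)
    (hn : 3 ≤ n) (hnδ : (2 * k + 1) * (1 + K / δ) * Real.log n ≤ n * (δ ^ 2 / 4))
    (hc₀ : c₀ ∈ feasibleTypes h α n) (hnear : n * klDiv (typeLaw n c₀) P ≤ 1) :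
    ∑ c ∈ feasibleTypes h α n, temperedPosterior h α P T n c * tvDist (typeLaw n c) P
      ≤ √(6 * k * (2 * k + 1) * (1 + K)) / 2 * √(Real.log n / n) + 1 / n := by
  have hPpos := hP.1.1
  refine (sum_mul_le_add_card_mul (r := √(6 * k * (2 * k + 1) * (1 + K)) / 2 * √(Real.log n / n))
    (η := Real.exp (-((2 * k + 1) * Real.log n)))
    (fun c _ => temperedPosterior_nonneg fun x => (hPpos x).le)
    (sum_temperedPosterior hPpos ⟨c₀, hc₀⟩ T) (by positivity) (Real.exp_pos _).le
    (fun c hc => tvDist_le_one (openSimplex_subset_stdSimplex (mem_feasibleTypes.1 hc).1)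
      (openSimplex_subset_stdSimplex hP.1)) fun c hc => ?_).trans
    (by gcongr; exact card_feasibleTypes_mul_exp_neg_le h α (by lia))
  have hcE := mem_feasibleTypes.1 hc
  rcases le_total (∑ x, (typeLaw n c x - P x) ^ 2)
    (6 * (2 * k + 1) * (1 + K) * (Real.log n / n)) with hclose | hfar
  · left
    calc tvDist (typeLaw n c) P ≤ √(k * ∑ x, (typeLaw n c x - P x) ^ 2) / 2 := by
          simpa using tvDist_le_sqrt_card_mul_sum_sq (typeLaw n c) P
      _ ≤ √(k * (6 * (2 * k + 1) * (1 + K) * (Real.log n / n))) / 2 := by gcongr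
      _ = √(6 * k * (2 * k + 1) * (1 + K)) / 2 * √(Real.log n / n) := by
          rw [div_mul_eq_mul_div, ← Real.sqrt_mul (by positivity)]
          ring_nf
  · exact .inr (temperedPosterior_le_exp_neg hPpos hT hn hcE.1 hc₀ hnear
      (mul_log_le_mul_klDiv_of_far hV hP hδ hPδ hK hTK (by lia) hnδ hcE hfar))

end Concentration

/-! ### Collapse of the tempered predictive laws -/

/-- The rate constant in the collapse bound for temperatures of at most `K` times the curvature: the
posterior has radius `√(6 (2k + 1) (1 + K) log n / n)` in Euclidean distance, Cauchy–Schwarz turns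
this into total variation distance, and `2` absorbs the terms of order `1 / n`. -/
noncomputable def collapseConstant (k : ℕ) (K : ℝ) : ℝ :=
  √(6 * k * (2 * k + 1) * (1 + K)) / 2 + 2

lemma two_le_collapseConstant (k : ℕ) (K : ℝ) : 2 ≤ collapseConstant k K :=
  le_add_of_nonneg_left (by positivity)

section Collapse

variable {δ K T : ℝ} {m n : ℕ} {c₀ : Fin k → ℕ}

lemma temperedPredictive_mem_stdSimplex (hQ : ∀ x, 0 < Q x) (hE : (feasibleTypes h α n).Nonempty)
    (T : ℝ) (hm : m ≤ n) : temperedPredictive h α Q T n m ∈ stdSimplex ℝ (Fin m → Fin k) := by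
  have hlaw : ∀ c ∈ feasibleTypes h α n,
      hypergeometricLaw n m c ∈ stdSimplex ℝ (Fin m → Fin k) := fun c hc =>
    hypergeometricLaw_mem_stdSimplex
      (sum_typeLaw_eq_one_iff.1 (mem_feasibleTypes.1 hc).1.2).2 hm
  refine ⟨fun y => Finset.sum_nonneg fun c hc => mul_nonneg ((hlaw c hc).1 y)
    (temperedPosterior_nonneg fun x => (hQ x).le), ?_⟩
  simp only [temperedPredictive]
  rw [Finset.sum_comm, ← sum_temperedPosterior hQ hE T]
  exact Finset.sum_congr rfl fun c hc => by rw [← Finset.sum_mul, (hlaw c hc).2, one_mul]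

lemma tvDist_hypergeometricLaw_le (hc : typeLaw n c₀ ∈ stdSimplex ℝ (Fin k))
    (hP : P ∈ stdSimplex ℝ (Fin k)) (hm : m ≤ n) :
    tvDist (hypergeometricLaw n m c₀) (productLaw P m)
      ≤ (m : ℝ) ^ 2 / n + m * tvDist (typeLaw n c₀) P :=
  (tvDist_triangle _ (productLaw (typeLaw n c₀) m) _).trans
    (add_le_add (tvDist_hypergeometricLaw_productLaw_le hc.2 hm) (tvDist_productLaw_le hc hP m))

lemma tvDist_temperedPredictive_le (hQ : ∀ x, 0 < Q x) (hP : P ∈ stdSimplex ℝ (Fin k))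
    (hE : (feasibleTypes h α n).Nonempty) (T : ℝ) (hm : m ≤ n) :
    tvDist (temperedPredictive h α Q T n m) (productLaw P m) ≤ (m : ℝ) ^ 2 / n +
      m * ∑ c ∈ feasibleTypes h α n, temperedPosterior h α Q T n c * tvDist (typeLaw n c) P := by
  have hw0 : ∀ c ∈ feasibleTypes h α n, 0 ≤ temperedPosterior h α Q T n c :=
    fun c _ => temperedPosterior_nonneg fun x => (hQ x).le
  have hw := sum_temperedPosterior (h := h) (α := α) hQ hE T
  calc tvDist (temperedPredictive h α Q T n m) (productLaw P m)
      ≤ ∑ c ∈ feasibleTypes h α n,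
          temperedPosterior h α Q T n c * tvDist (hypergeometricLaw n m c) (productLaw P m) :=
        tvDist_sum_mul_le _ hw0 hw _ _
    _ ≤ ∑ c ∈ feasibleTypes h α n,
          temperedPosterior h α Q T n c * ((m : ℝ) ^ 2 / n + m * tvDist (typeLaw n c) P) :=
        Finset.sum_le_sum fun c hc => mul_le_mul_of_nonneg_left
          (tvDist_hypergeometricLaw_le
            (openSimplex_subset_stdSimplex (mem_feasibleTypes.1 hc).1) hP hm) (hw0 c hc)
    _ = _ := by
        simp only [mul_add, Finset.sum_add_distrib, ← Finset.sum_mul, hw, one_mul,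
          mul_left_comm _ (m : ℝ), ← Finset.mul_sum]

lemma sqrt_log_div_le_one (n : ℕ) : √(Real.log n / n) ≤ 1 :=
  Real.sqrt_le_one.2 (div_le_one_of_le₀ (Real.log_le_self n.cast_nonneg) n.cast_nonneg)

lemma one_div_le_sqrt_log_div_sq (hn : 3 ≤ n) : 1 / (n : ℝ) ≤ √(Real.log n / n) ^ 2 := by
  rw [Real.sq_sqrt (div_nonneg (Real.log_natCast_nonneg n) n.cast_nonneg)]
  exact div_le_div_of_nonneg_right (one_le_log_of_three_le hn) n.cast_nonneg

lemma one_div_le_sqrt_log_div (hn : 3 ≤ n) : 1 / (n : ℝ) ≤ √(Real.log n / n) :=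
  (one_div_le_sqrt_log_div_sq hn).trans
    (pow_le_of_le_one (Real.sqrt_nonneg _) (sqrt_log_div_le_one n) two_ne_zero)

lemma collapseBound_of_mul_klDiv_le_one (hV : tangentSpace h ≠ ⊥) (hP : P ∈ feasibleSet h α)
    (hδ : 0 < δ) (hPδ : ∀ x, δ ≤ P x) (hK : 0 ≤ K) (hT : 0 < T) (hTK : T ≤ K * lambdaMin h P)
    (hn : 3 ≤ n) (hnδ : (2 * k + 1) * (1 + K / δ) * Real.log n ≤ n * (δ ^ 2 / 4))
    (hc₀ : c₀ ∈ feasibleTypes h α n) (hnear : n * klDiv (typeLaw n c₀) P ≤ 1) :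
    CollapseBound h α P P T (collapseConstant k K) n := by
  intro m hm
  have hPstd := openSimplex_subset_stdSimplex hP.1
  set s := √(Real.log n / n)
  have hms0 : 0 ≤ m * s := mul_nonneg m.cast_nonneg (Real.sqrt_nonneg _)
  rcases le_total 1 (m * s) with hms | hms
  · calc tvDist (temperedPredictive h α P T n m) (productLaw P m) ≤ 1 :=
          tvDist_le_one (temperedPredictive_mem_stdSimplex hP.1.1 ⟨c₀, hc₀⟩ T hm)
            (productLaw_mem_stdSimplex hPstd m)
      _ ≤ collapseConstant k K * (m * s) :=
          one_le_mul_of_one_le_of_one_le (by linarith [two_le_collapseConstant k K]) hms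
  · have hposterior := sum_temperedPosterior_mul_tvDist_le hV hP hδ hPδ hK hT hTK hn hnδ hc₀ hnear
    calc tvDist (temperedPredictive h α P T n m) (productLaw P m)
        ≤ (m : ℝ) ^ 2 * (1 / n)
            + m * (√(6 * k * (2 * k + 1) * (1 + K)) / 2 * s + 1 / n) := by
          rw [mul_one_div]
          exact (tvDist_temperedPredictive_le hP.1.1 hPstd ⟨c₀, hc₀⟩ T hm).trans (by gcongr)
      _ ≤ (m : ℝ) ^ 2 * s ^ 2 + m * (√(6 * k * (2 * k + 1) * (1 + K)) / 2 * s + s) := by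
          gcongr
          exacts [one_div_le_sqrt_log_div_sq hn, one_div_le_sqrt_log_div hn]
      _ = (m * s) ^ 2 + (√(6 * k * (2 * k + 1) * (1 + K)) / 2 + 1) * (m * s) := by ring
      _ ≤ m * s + (√(6 * k * (2 * k + 1) * (1 + K)) / 2 + 1) * (m * s) := by
          gcongr
          exact pow_le_of_le_one hms0 hms two_ne_zero
      _ = collapseConstant k K * (m * s) := by
          rw [collapseConstant]
          ring

lemma CollapseBound.of_isInfoProjection {C : ℝ} (hQ : ∀ x, 0 < Q x) (hP : IsInfoProjection h α Q P)
    (hbound : CollapseBound h α P P T C n) : CollapseBound h α Q P T C n := fun m hm => by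
  rw [temperedPredictive_eq_of_isInfoProjection hQ hP]
  exact hbound m hm

lemma klDiv_le_of_abs_sub_le {r : ℝ} (hP : P ∈ openSimplex k) (hQ : Q ∈ openSimplex k)
    (hδ : 0 < δ) (hQδ : ∀ x, δ ≤ Q x) (hr : ∀ x, |P x - Q x| ≤ r) :
    klDiv P Q ≤ k * (r ^ 2 / δ) := by
  refine (klDiv_le_sum_sq_sub_div hP hQ).trans ?_
  refine (Finset.sum_le_card_nsmul _ _ (r ^ 2 / δ) fun x _ => ?_).trans_eq (by simp)
  exact div_le_div₀ (sq_nonneg r) (sq_le_sq' (abs_le.1 (hr x)).1 (abs_le.1 (hr x)).2) hδ (hQδ x)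

lemma eventually_mul_klDiv_le_one (hL : IsLatticeFeature h) (hδ : 0 < δ) :
    ∀ᶠ n : ℕ in atTop, ∀ α, ∀ P ∈ feasibleSet h α, (∀ x, δ ≤ P x) →
      (feasibleTypes h α n).Nonempty →
      ∃ c ∈ feasibleTypes h α n, n * klDiv (typeLaw n c) P ≤ 1 := by
  obtain ⟨B, hB⟩ := exists_mem_feasibleTypes_abs_sub_le hL
  filter_upwards [eventually_gt_atTop 0,
    (tendsto_natCast_atTop_atTop (R := ℝ)).eventually_gt_atTop (B / δ),
    (tendsto_natCast_atTop_atTop (R := ℝ)).eventually_ge_atTop (k * (B ^ 2 / δ))]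
    with n hn hBn hBn' α P hP hPδ hE
  have hn0 : (0 : ℝ) < n := by exact_mod_cast hn
  obtain ⟨c, hc, hdist⟩ := hB α P δ n hP hPδ ((div_lt_iff₀ hδ).1 hBn) hE
  refine ⟨c, hc, ?_⟩
  calc n * klDiv (typeLaw n c) P ≤ n * (k * ((B / n) ^ 2 / δ)) := by
        gcongr
        exact klDiv_le_of_abs_sub_le (mem_feasibleTypes.1 hc).1 hP.1 hδ hPδ hdist
    _ = k * (B ^ 2 / δ) / n := by field_simp
    _ ≤ 1 := (div_le_one hn0).2 hBn'

lemma eventually_mul_log_le_mul (a : ℝ) {b : ℝ} (hb : 0 < b) :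
    ∀ᶠ n : ℕ in atTop, a * Real.log n ≤ n * b := by
  have hlim : Tendsto (fun n : ℕ => a * (Real.log n / n)) atTop (𝓝 0) := by
    simpa using (Real.isLittleO_log_id_atTop.tendsto_div_nhds_zero.comp
      tendsto_natCast_atTop_atTop).const_mul a
  filter_upwards [hlim.eventually_le_const hb, eventually_gt_atTop 0] with n hle hn
  rwa [← mul_div_assoc, div_le_iff₀ (by positivity), mul_comm b] at hle

lemma eventually_collapseBound (hL : IsLatticeFeature h) (hV : tangentSpace h ≠ ⊥) (hδ : 0 < δ)
    (K : ℝ) :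
    ∀ᶠ n : ℕ in atTop, ∀ (Q P : Fin k → ℝ) (α : Fin d → ℝ) (T : ℝ), IsModel h δ Q α P →
      T ∈ Set.Ioc 0 (K * lambdaMin h P) → (feasibleTypes h α n).Nonempty →
      CollapseBound h α Q P T (collapseConstant k K) n := by
  filter_upwards [eventually_ge_atTop 3, eventually_mul_klDiv_le_one hL hδ,
    eventually_mul_log_le_mul ((2 * k + 1) * (1 + K / δ)) (show 0 < δ ^ 2 / 4 by positivity)]
    with n hn hround hnδ Q P α T ⟨hQ, hP, hPδ⟩ hT hE
  obtain ⟨c₀, hc₀, hnear⟩ := hround α P hP.1 hPδ hE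
  have hK : 0 < K := pos_of_mul_pos_left (hT.1.trans_le hT.2)
    (zero_le_one.trans (one_le_lambdaMin hV hP.1.1))
  exact (collapseBound_of_mul_klDiv_le_one hV hP.1 hδ hPδ hK.le hT.1 hT.2 hn hnδ hc₀
    hnear).of_isInfoProjection hQ.1 hP

end Collapse

/-! ### Predictive calibration -/

/-- Tempered predictive probabilities of all events are within `ε` of the actual conditional ones
and of those under `P^{⊗m}`. -/
def IsCalibrated (h : Fin k → Fin d → ℝ) (α : Fin d → ℝ) (Q P : Fin k → ℝ) (T ε : ℝ) (n m : ℕ) :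
    Prop :=
  ∀ S : Finset (Fin m → Fin k),
    |∑ y ∈ S, temperedPredictive h α Q T n m y - ∑ y ∈ S, temperedPredictive h α Q 1 n m y| ≤ ε ∧
    |∑ y ∈ S, temperedPredictive h α Q T n m y - ∑ y ∈ S, productLaw P m y| ≤ ε

section Calibration

variable {C T δ ε : ℝ} {n m : ℕ}

lemma CollapseBound.abs_sum_sub_sum_le (hQ : ∀ x, 0 < Q x) (hP : P ∈ stdSimplex ℝ (Fin k))
    (hE : (feasibleTypes h α n).Nonempty) (hbound : CollapseBound h α Q P T C n) (hm : m ≤ n)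
    (S : Finset (Fin m → Fin k)) :
    |∑ y ∈ S, temperedPredictive h α Q T n m y - ∑ y ∈ S, productLaw P m y|
      ≤ C * (m * √(Real.log n / n)) :=
  (abs_sum_sub_sum_le_tvDist ((temperedPredictive_mem_stdSimplex hQ hE T hm).2.trans
    (productLaw_mem_stdSimplex hP m).2.symm) S).trans (hbound m hm)

lemma isCalibrated_of_collapseBound (hQ : ∀ x, 0 < Q x) (hP : P ∈ stdSimplex ℝ (Fin k))
    (hE : (feasibleTypes h α n).Nonempty) (hT : CollapseBound h α Q P T C n)
    (hone : CollapseBound h α Q P 1 C n) (hm : m ≤ n)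
    (hε : C * (m * √(Real.log n / n)) ≤ ε / 2) : IsCalibrated h α Q P T ε n m := fun S => by
  have htempered := (hT.abs_sum_sub_sum_le hQ hP hE hm S).trans hε
  have hactual := (hone.abs_sum_sub_sum_le hQ hP hE hm S).trans hε
  have hε0 : 0 ≤ ε / 2 := (abs_nonneg _).trans htempered
  refine ⟨?_, by linarith⟩
  rw [abs_sub_comm] at hactual
  exact (abs_sub_le _ _ _).trans (by linarith)

lemma eventually_le_of_tendsto_mul_sqrt_log {m : ℕ → ℕ}
    (hm : Tendsto (fun n : ℕ => (m n : ℝ) * √(Real.log n / n)) atTop (𝓝 0)) :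
    ∀ᶠ n in atTop, m n ≤ n := by
  filter_upwards [hm.eventually_le_const one_pos, eventually_ge_atTop 3] with n hmn hn
  have hle : (m n : ℝ) * (1 / n) ≤ 1 :=
    (mul_le_mul_of_nonneg_left (one_div_le_sqrt_log_div hn) (Nat.cast_nonneg _)).trans hmn
  rw [mul_one_div, div_le_one (by positivity)] at hle
  exact_mod_cast hle

lemma eventually_isCalibrated (hL : IsLatticeFeature h) (hV : tangentSpace h ≠ ⊥) (hδ : 0 < δ)
    (K : ℝ) {m : ℕ → ℕ}
    (hm : Tendsto (fun n : ℕ => (m n : ℝ) * √(Real.log n / n)) atTop (𝓝 0)) (hε : 0 < ε) :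
    ∀ᶠ n : ℕ in atTop, ∀ (Q P : Fin k → ℝ) (α : Fin d → ℝ) (T : ℝ), IsModel h δ Q α P →
      T ∈ Set.Ioc 0 (K * lambdaMin h P) → (feasibleTypes h α n).Nonempty →
      IsCalibrated h α Q P T ε n (m n) := by
  have hrate : ∀ᶠ n : ℕ in atTop,
      collapseConstant k (max K 1) * (m n * √(Real.log n / n)) ≤ ε / 2 := by
    refine Tendsto.eventually_le_const (half_pos hε) ?_
    simpa only [mul_zero] using hm.const_mul (collapseConstant k (max K 1))
  filter_upwards [eventually_collapseBound hL hV hδ (max K 1), hrate,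
    eventually_le_of_tendsto_mul_sqrt_log hm] with n hbound hrate hmn Q P α T hmod hT hE
  have hlam := one_le_lambdaMin hV hmod.2.1.1.1
  have hTmax : T ≤ max K 1 * lambdaMin h P :=
    hT.2.trans (mul_le_mul_of_nonneg_right (le_max_left K 1) (by linarith))
  have honemax : 1 ≤ max K 1 * lambdaMin h P :=
    one_le_mul_of_one_le_of_one_le (le_max_right K 1) hlam
  exact isCalibrated_of_collapseBound hmod.1.1 (openSimplex_subset_stdSimplex hmod.2.1.1.1) hE
    (hbound Q P α T hmod ⟨hT.1, hTmax⟩ hE) (hbound Q P α 1 hmod ⟨one_pos, honemax⟩ hE) hmn hrate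

end Calibration

/-! ### Credible regions -/

/-- At every threshold the actual conditional coverage of the highest-density region of the tempered
posterior is at least its nominal level. -/
def HasConservativeRegions (h : Fin k → Fin d → ℝ) (α : Fin d → ℝ) (Q : Fin k → ℝ) (T : ℝ)
    (n : ℕ) : Prop :=
  ∀ t : ℝ, ∑ c ∈ hpdRegion h α Q T n t, temperedPosterior h α Q T n c
    ≤ ∑ c ∈ hpdRegion h α Q T n t, temperedPosterior h α Q 1 n c

lemma sum_mul_sum_le_sum_mul_sum_of_subset {ι : Type*} [DecidableEq ι] {R E : Finset ι}
    {f g : ι → ℝ} (hRE : R ⊆ E) (hfg : ∀ c ∈ R, ∀ e ∈ E \ R, f c * g e ≤ g c * f e) :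
    (∑ c ∈ R, f c) * ∑ e ∈ E, g e ≤ (∑ c ∈ R, g c) * ∑ e ∈ E, f e := by
  have hcross : (∑ c ∈ R, f c) * ∑ e ∈ E \ R, g e ≤ (∑ c ∈ R, g c) * ∑ e ∈ E \ R, f e := by
    rw [Finset.sum_mul_sum, Finset.sum_mul_sum]
    exact Finset.sum_le_sum fun c hc => Finset.sum_le_sum fun e he => hfg c hc e he
  rw [← Finset.sum_sdiff hRE, ← Finset.sum_sdiff hRE (f := f)]
  linarith

lemma rpow_mul_le_mul_rpow {x y s : ℝ} (hy : 0 < y) (hyx : y ≤ x) (hs : s ≤ 1) :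
    x ^ s * y ≤ x * y ^ s := by
  have hx := hy.trans_le hyx
  have hsplit : ∀ z : ℝ, 0 < z → z = z ^ s * z ^ (1 - s) := fun z hz => by
    rw [← Real.rpow_add hz, add_sub_cancel, Real.rpow_one]
  calc x ^ s * y = x ^ s * y ^ s * y ^ (1 - s) := by rw [mul_assoc, ← hsplit y hy]
    _ ≤ x ^ s * y ^ s * x ^ (1 - s) := by gcongr
    _ = x * y ^ s := by rw [mul_right_comm, ← hsplit x hx]

lemma hasConservativeRegions_of_one_le (hQ : ∀ x, 0 < Q x) {T : ℝ} (hT : 1 ≤ T) {n : ℕ}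
    (hE : (feasibleTypes h α n).Nonempty) : HasConservativeRegions h α Q T n := fun t => by
  classical
  have hpos := typeProb_pos hQ
  have hZ := sum_typeProb_rpow_pos hQ hE
  have hratio : ∀ c ∈ hpdRegion h α Q T n t, ∀ e ∈ feasibleTypes h α n \ hpdRegion h α Q T n t,
      typeProb Q c ^ (1 / T) * typeProb Q e ^ (1 / (1 : ℝ))
        ≤ typeProb Q c ^ (1 / (1 : ℝ)) * typeProb Q e ^ (1 / T) := fun c hc e he => by
    simp only [hpdRegion, Finset.mem_sdiff, Finset.mem_filter, not_and, not_le] at hc he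
    have hdensity := (div_lt_div_iff_of_pos_right (hZ (1 / T))).1 ((he.2 he.1).trans_le hc.2)
    rw [Real.rpow_lt_rpow_iff (hpos e).le (hpos c).le (by positivity)] at hdensity
    rw [div_one, Real.rpow_one, Real.rpow_one]
    exact rpow_mul_le_mul_rpow (hpos e) hdensity.le ((div_le_one (by positivity)).2 hT)
  simp only [temperedPosterior]
  rw [← Finset.sum_div, ← Finset.sum_div, div_le_div_iff₀ (hZ _) (hZ _)]
  exact sum_mul_sum_le_sum_mul_sum_of_subset (Finset.filter_subset _ _) hratio

/-! ### Temperatures and estimated curvature -/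

section Temperature

variable {β lam0 l u x a b T : ℝ}

lemma one_le_logTemperature (hβ : 0 ≤ β) (hlam0 : 0 ≤ lam0) (hx : 0 ≤ x) :
    1 ≤ logTemperature β lam0 x :=
  le_add_of_nonneg_right
    (mul_nonneg hβ (Real.log_nonneg (le_add_of_nonneg_right (div_nonneg hx hlam0))))

lemma logTemperature_le (hβ : 0 ≤ β) (hlam0 : 0 ≤ lam0) (hx : 0 ≤ x) :
    logTemperature β lam0 x ≤ 1 + β / lam0 * x := by
  have hpos : 0 < 1 + x / lam0 := by linarith [div_nonneg hx hlam0]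
  calc logTemperature β lam0 x ≤ 1 + β * (1 + x / lam0 - 1) := by
        unfold logTemperature
        gcongr
        exact Real.log_le_sub_one_of_pos hpos
    _ = 1 + β / lam0 * x := by ring

lemma logTemperature_div_mem_Icc (hβ : 0 ≤ β) (hlam0 : 0 ≤ lam0) (hl : 0 < l)
    (hx : x ∈ Set.Icc l u) :
    logTemperature β lam0 x / x ∈ Set.Icc (1 / (|u| + 1)) (1 / l + β / lam0) := by
  have hx0 : 0 < x := hl.trans_le hx.1
  have hone := one_le_logTemperature hβ hlam0 hx0.le
  constructor
  · exact div_le_div₀ (by linarith) hone hx0 (by linarith [hx.2, le_abs_self u])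
  · calc logTemperature β lam0 x / x ≤ (1 + β / lam0 * x) / x := by
          gcongr
          exact logTemperature_le hβ hlam0 hx0.le
      _ = 1 / x + β / lam0 := by field_simp
      _ ≤ 1 / l + β / lam0 := by
          gcongr
          exact hx.1

lemma mem_Ioc_two_mul_lambdaMin_of_abs_sub_lt_one (hV : tangentSpace h ≠ ⊥)
    (hP : P ∈ openSimplex k) (hx : |x - lambdaMin h P| < 1) :
    x ∈ Set.Ioc 0 (2 * lambdaMin h P) := by
  have hlam := one_le_lambdaMin hV hP
  constructor <;> linarith [(abs_lt.1 hx).1, (abs_lt.1 hx).2]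

lemma mem_Ioc_mul_lambdaMin_of_div_mem_Icc (hV : tangentSpace h ≠ ⊥) (hP : P ∈ openSimplex k)
    (hx : |x - lambdaMin h P| < 1) (ha : 0 < a) (hT : T / x ∈ Set.Icc a b) :
    T ∈ Set.Ioc 0 (2 * b * lambdaMin h P) := by
  obtain ⟨hx0, hxlam⟩ := mem_Ioc_two_mul_lambdaMin_of_abs_sub_lt_one hV hP hx
  have hb : 0 ≤ b := ha.le.trans (hT.1.trans hT.2)
  refine ⟨(div_pos_iff_of_pos_right hx0).1 (ha.trans_le hT.1), ?_⟩
  calc T ≤ b * x := (div_le_iff₀ hx0).1 hT.2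
    _ ≤ b * (2 * lambdaMin h P) := mul_le_mul_of_nonneg_left hxlam hb
    _ = 2 * b * lambdaMin h P := by ring

lemma logTemperature_mem_Icc_one_mul_lambdaMin (hV : tangentSpace h ≠ ⊥) (hP : P ∈ openSimplex k)
    (hx : |x - lambdaMin h P| < 1) (hβ : 0 ≤ β) (hlam0 : 0 ≤ lam0) :
    logTemperature β lam0 x ∈ Set.Icc 1 ((1 + 2 * (β / lam0)) * lambdaMin h P) := by
  obtain ⟨hx0, hxlam⟩ := mem_Ioc_two_mul_lambdaMin_of_abs_sub_lt_one hV hP hx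
  refine ⟨one_le_logTemperature hβ hlam0 hx0.le, ?_⟩
  calc logTemperature β lam0 x ≤ 1 + β / lam0 * x := logTemperature_le hβ hlam0 hx0.le
    _ ≤ lambdaMin h P + β / lam0 * (2 * lambdaMin h P) := by
        gcongr
        exact one_le_lambdaMin hV hP
    _ = (1 + 2 * (β / lam0)) * lambdaMin h P := by ring

end Temperature

section Negligible

variable {ι : Type*} {Ω : ι → ℕ → Type*} [∀ i n, MeasurableSpace (Ω i n)]
  {ℙ : ∀ i n, Measure (Ω i n)} {A B : ∀ i n, Set (Ω i n)}

lemma UniformlyNegligible.mono (hB : UniformlyNegligible ℙ B)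
    (hAB : ∀ᶠ n in atTop, ∀ i, A i n ⊆ B i n) : UniformlyNegligible ℙ A := fun η hη => by
  filter_upwards [hB η hη, hAB] with n hBn hsub i
  exact (measure_mono (hsub i)).trans (hBn i)

lemma UniformlyNegligible.union (hA : UniformlyNegligible ℙ A) (hB : UniformlyNegligible ℙ B) :
    UniformlyNegligible ℙ fun i n => A i n ∪ B i n := fun η hη => by
  have hη2 : 0 < η / 2 := ENNReal.half_pos hη.ne'
  filter_upwards [hA _ hη2, hB _ hη2] with n hAn hBn i
  calc ℙ i n (A i n ∪ B i n) ≤ ℙ i n (A i n) + ℙ i n (B i n) := measure_union_le _ _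
    _ ≤ η / 2 + η / 2 := add_le_add (hAn i) (hBn i)
    _ = η := ENNReal.add_halves η

end Negligible

end Tempering

theorem mainTheorem10_general (k : ℕ) (K : ℝ) :
    ∃ C : ℝ, 0 < C ∧
      ∀ (d : ℕ) (h : Fin k → Fin d → ℝ) (δ : ℝ),
        Tempering.IsLatticeFeature h → Tempering.tangentSpace h ≠ ⊥ → 0 < δ →
      ∀ (ι : Type*) (Q P : ι → Fin k → ℝ) (α : ι → Fin d → ℝ),
        (∀ i, Tempering.IsModel h δ (Q i) (α i) (P i)) →
      ∀ (Ω : ι → ℕ → Type*) [∀ i n, MeasurableSpace (Ω i n)] (ℙ : ∀ i n, Measure (Ω i n))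
        (T : ∀ i n, Ω i n → ℝ),
        Tempering.UniformlyNegligible ℙ
          (fun i n => {ω | T i n ω ∉ Set.Ioc 0 (K * Tempering.lambdaMin h (P i))}) →
        Tempering.UniformlyNegligible ℙ
          (fun i n => {ω | (Tempering.feasibleTypes h (α i) n).Nonempty ∧
            ¬ Tempering.CollapseBound h (α i) (Q i) (P i) (T i n ω) C n}) ∧
        (∀ m : ℕ → ℕ, Tendsto (fun n : ℕ => (m n : ℝ) * √(Real.log n / n)) atTop (𝓝 0) →
          ∀ ε : ℝ, 0 < ε → Tempering.UniformlyNegligible ℙ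
            (fun i n => {ω | (Tempering.feasibleTypes h (α i) n).Nonempty ∧
              ¬ Tempering.IsCalibrated h (α i) (Q i) (P i) (T i n ω) ε n (m n)})) ∧
        (Tempering.UniformlyNegligible ℙ (fun i n => {ω | ¬ 1 ≤ T i n ω}) →
          Tempering.UniformlyNegligible ℙ
            (fun i n => {ω | (Tempering.feasibleTypes h (α i) n).Nonempty ∧
              ¬ Tempering.HasConservativeRegions h (α i) (Q i) (T i n ω) n})) := by
  refine ⟨Tempering.collapseConstant k K, two_pos.trans_le (Tempering.two_le_collapseConstant k K),
    fun d h δ hL hV hδ ι Q P α hmod Ω _ ℙ T hT => ⟨hT.mono ?_, fun m hm ε hε => hT.mono ?_,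
      fun hT1 => hT1.mono (.of_forall fun n i ω hω hTω => ?_)⟩⟩
  · filter_upwards [Tempering.eventually_collapseBound hL hV hδ K] with n hcollapse i ω hω hTω
    exact hω.2 (hcollapse _ _ _ _ (hmod i) hTω hω.1)
  · filter_upwards [Tempering.eventually_isCalibrated hL hV hδ K hm hε] with n hcalibrated
      i ω hω hTω
    exact hω.2 (hcalibrated _ _ _ _ (hmod i) hTω hω.1)
  · exact hω.2 (Tempering.hasConservativeRegions_of_one_le (hmod i).1.1 hTω hω.1)

theorem mainTheorem10 :
    -- Every temperature comparable to the estimated curvature gives the collapse rate.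
    (∀ (k : ℕ) (l u a b : ℝ), 0 < l → 0 < a →
      ∃ C : ℝ, 0 < C ∧
        ∀ (d : ℕ) (h : Fin k → Fin d → ℝ) (δ : ℝ),
          Tempering.IsLatticeFeature h → Tempering.tangentSpace h ≠ ⊥ → 0 < δ →
        ∀ (ι : Type*) (Q P : ι → Fin k → ℝ) (α : ι → Fin d → ℝ),
          (∀ i, Tempering.IsModel h δ (Q i) (α i) (P i)) →
          (∀ i, Tempering.lambdaMin h (P i) ∈ Set.Icc l u) →
        ∀ (Ω : ι → ℕ → Type*) [∀ i n, MeasurableSpace (Ω i n)]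
          (ℙ : ∀ i n, Measure (Ω i n)) [∀ i n, IsProbabilityMeasure (ℙ i n)]
          (lamHat T : ∀ i n, Ω i n → ℝ),
          Tempering.IsConsistent ℙ lamHat (fun i => Tempering.lambdaMin h (P i)) →
          Tempering.UniformlyNegligible ℙ
            (fun i n => {ω | T i n ω / lamHat i n ω ∉ Set.Icc a b}) →
          Tempering.UniformlyNegligible ℙ
            (fun i n => {ω | (Tempering.feasibleTypes h (α i) n).Nonempty ∧
              ¬ Tempering.CollapseBound h (α i) (Q i) (P i) (T i n ω) C n})) ∧
    -- The logarithmic temperature.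
    (∀ (k : ℕ) (β lam0 : ℝ), 0 < β → 0 < lam0 →
      -- It is comparable to the curvature over every bounded range of curvatures.
      (∀ l u : ℝ, 0 < l → ∃ a b : ℝ, 0 < a ∧
        ∀ x ∈ Set.Icc l u, Tempering.logTemperature β lam0 x / x ∈ Set.Icc a b) ∧
      ∃ C : ℝ, 0 < C ∧
        ∀ (d : ℕ) (h : Fin k → Fin d → ℝ) (δ : ℝ),
          Tempering.IsLatticeFeature h → Tempering.tangentSpace h ≠ ⊥ → 0 < δ →
        ∀ (ι : Type*) (Q P : ι → Fin k → ℝ) (α : ι → Fin d → ℝ),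
          (∀ i, Tempering.IsModel h δ (Q i) (α i) (P i)) →
        ∀ (Ω : ι → ℕ → Type*) [∀ i n, MeasurableSpace (Ω i n)]
          (ℙ : ∀ i n, Measure (Ω i n)) [∀ i n, IsProbabilityMeasure (ℙ i n)]
          (lamHat : ∀ i n, Ω i n → ℝ),
          Tempering.IsConsistent ℙ lamHat (fun i => Tempering.lambdaMin h (P i)) →
          -- Rates are stable across all curvatures.
          Tempering.UniformlyNegligible ℙ
            (fun i n => {ω | (Tempering.feasibleTypes h (α i) n).Nonempty ∧
              ¬ Tempering.CollapseBound h (α i) (Q i) (P i)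
                (Tempering.logTemperature β lam0 (lamHat i n ω)) C n}) ∧
          -- Predictive calibration: tempered predictive probabilities of events agree
          -- asymptotically with the actual conditional ones and with those under the benchmark.
          (∀ m : ℕ → ℕ,
            Tendsto (fun n : ℕ => (m n : ℝ) * Real.sqrt (Real.log n / n)) atTop (𝓝 0) →
            ∀ ε : ℝ, 0 < ε →
            Tempering.UniformlyNegligible ℙ
              (fun i n => {ω | (Tempering.feasibleTypes h (α i) n).Nonempty ∧
                ¬ ∀ S : Finset (Fin (m n) → Fin k),
                  |∑ y ∈ S, Tempering.temperedPredictive h (α i) (Q i)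
                      (Tempering.logTemperature β lam0 (lamHat i n ω)) n (m n) y
                    - ∑ y ∈ S, Tempering.temperedPredictive h (α i) (Q i) 1 n (m n) y| ≤ ε ∧
                  |∑ y ∈ S, Tempering.temperedPredictive h (α i) (Q i)
                      (Tempering.logTemperature β lam0 (lamHat i n ω)) n (m n) y
                    - ∑ y ∈ S, Tempering.productLaw (P i) (m n) y| ≤ ε})) ∧
          -- Credible regions: the actual conditional coverage of a highest-density region of the
          -- tempered posterior is at least its nominal level.
          Tempering.UniformlyNegligible ℙ
            (fun i n => {ω | (Tempering.feasibleTypes h (α i) n).Nonempty ∧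
              ¬ ∀ t : ℝ,
                ∑ c ∈ Tempering.hpdRegion h (α i) (Q i)
                    (Tempering.logTemperature β lam0 (lamHat i n ω)) n t,
                  Tempering.temperedPosterior h (α i) (Q i)
                    (Tempering.logTemperature β lam0 (lamHat i n ω)) n c
                ≤ ∑ c ∈ Tempering.hpdRegion h (α i) (Q i)
                    (Tempering.logTemperature β lam0 (lamHat i n ω)) n t,
                  Tempering.temperedPosterior h (α i) (Q i) 1 n c})) := by
  refine ⟨fun k l u a b _ ha => ?_, fun k β lam0 hβ hlam0 => ⟨fun l u hl => ?_, ?_⟩⟩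
  · obtain ⟨C, hC, hgeneral⟩ := mainTheorem10_general k (2 * b)
    refine ⟨C, hC, fun d h δ hL hV hδ ι Q P α hmod _ Ω _ ℙ _ lamHat T hest hratio =>
      (hgeneral d h δ hL hV hδ ι Q P α hmod Ω ℙ T ?_).1⟩
    refine ((hest 1 one_pos).union hratio).mono (.of_forall fun n i ω hω => ?_)
    refine or_iff_not_and_not.2 fun hgood => hω ?_
    exact Tempering.mem_Ioc_mul_lambdaMin_of_div_mem_Icc hV (hmod i).2.1.1.1 (not_le.1 hgood.1) ha
      (not_not.1 hgood.2)
  · exact ⟨1 / (|u| + 1), 1 / l + β / lam0, by positivity,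
      fun x hx => Tempering.logTemperature_div_mem_Icc hβ.le hlam0.le hl hx⟩
  · obtain ⟨C, hC, hgeneral⟩ := mainTheorem10_general k (1 + 2 * (β / lam0))
    refine ⟨C, hC, fun d h δ hL hV hδ ι Q P α hmod Ω _ ℙ _ lamHat hest => ?_⟩
    have htemp : ∀ i n ω, |lamHat i n ω - Tempering.lambdaMin h (P i)| < 1 →
        Tempering.logTemperature β lam0 (lamHat i n ω)
          ∈ Set.Icc 1 ((1 + 2 * (β / lam0)) * Tempering.lambdaMin h (P i)) := fun i n ω hω =>
      Tempering.logTemperature_mem_Icc_one_mul_lambdaMin hV (hmod i).2.1.1.1 hω hβ.le hlam0.le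
    obtain ⟨hcollapse, hcalibrated, hregions⟩ := hgeneral d h δ hL hV hδ ι Q P α hmod Ω ℙ
      (fun i n ω => Tempering.logTemperature β lam0 (lamHat i n ω))
      ((hest 1 one_pos).mono (.of_forall fun n i ω hω => not_lt.1 fun hlt => hω
        ⟨one_pos.trans_le (htemp i n ω hlt).1, (htemp i n ω hlt).2⟩))
    exact ⟨hcollapse, hcalibrated, hregions ((hest 1 one_pos).mono
      (.of_forall fun n i ω hω => not_lt.1 fun hlt => hω (htemp i n ω hlt).1))⟩
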